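/- Let $d\ge 2$ and let $X=(X_i)_{i\in\mathbb Z^d}$ be a real-valued random field that is translation invariant (for every $a\in\mathbb Z^d$ the fields $(X_{i+a})_i$ and $(X_i)_i$ have the same law), with $\mathbf E[X_i]=0$, $\mathrm{Var}(X_i)=1$ and all moments finite. For $k\ge 1$ let $\rho_k(i_1,\dots,i_k)=\mathbf E[X_{i_1}\cdots X_{i_k}]$, and let the truncated correlation functions (joint cumulants) be $$\rho_k^T(i_1,\dots,i_k)=\sum_{\pi\in\mathcal P(k)}(|\pi|-1)!\,(-1)^{|\pi|-1}\prod_{B\in\pi}\rho_{|B|}(i_j: j\in B),$$ where $\mathcal P(k)$ is the set of all partitions of $\{1,\dots,k\}$ and $|\pi|$ is the number of blocks of $\pi$. Suppose that for every $k\ge 1$ the sums $\sum_{i_2,\dots,i_k\in\mathbb Z^d}\rho_k^T(i_1,\dots,i_k)$ converge (unconditionally, equivalently absolutely) and $$\sup_{i_1\in\mathbb Z^d}\ \sum_{i_2,\dots,i_k\in\mathbb Z^d}\rho_k^T(i_1,\dots,i_k)<\infty .$$ For $L>0$ let $\mathcal B_L=\{x\in\mathbb R^d:\|x\|\le L\}$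 be the closed Euclidean ball and $Q_{\mathcal B_L}=\sum_{i\in\mathbb Z^d\cap\mathcal B_L}X_i$. Then, as $L\to\infty$ through the real numbers, $$\frac{Q_{\mathcal B_L}-\mathbf E[Q_{\mathcal B_L}]}{\sqrt{\mathrm{Var}(Q_{\mathcal B_L})}}\longrightarrow \mathcal N(0,1)\quad\text{in distribution.}$$ -/

import Mathlib

open MeasureTheory ProbabilityTheory Filter

noncomputable section

namespace LatticeField

/-- The site `i ∈ ℤ^d` as a point of the Euclidean space `ℝ^d`. -/
def toSpace {d : ℕ} (i : Fin d → ℤ) : EuclideanSpace ℝ (Fin d) :=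
  WithLp.toLp 2 (fun k => (i k : ℝ))

/-- The closed Euclidean ball `B_L = {x ∈ ℝ^d : ‖x‖ ≤ L}`. -/
def ball (d : ℕ) (L : ℝ) : Set (EuclideanSpace ℝ (Fin d)) :=
  Metric.closedBall 0 L

/-- The local mass `Q_Λ(X) = ∑_{i ∈ Λ ∩ ℤ^d} X_i` (a finite sum when `Λ` is bounded). -/
def localMass {Ω : Type*} {d : ℕ} (X : (Fin d → ℤ) → Ω → ℝ)
    (Λ : Set (EuclideanSpace ℝ (Fin d))) (ω : Ω) : ℝ :=
  ∑ᶠ i ∈ {i : Fin d → ℤ | toSpace i ∈ Λ}, X i ω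

/-- A ball contains only finitely many sites, so its local mass is an honest finite sum. -/
theorem finite_sites_ball (d : ℕ) (L : ℝ) :
    {i : Fin d → ℤ | toSpace i ∈ ball d L}.Finite := by
  refine (Set.finite_Icc (fun _ : Fin d => -⌈L⌉) (fun _ => ⌈L⌉)).subset ?_
  intro i hi
  have h1 : ‖toSpace i‖ ≤ L := by simpa [ball] using hi
  have h2 : ∀ k, |(i k : ℝ)| ≤ (⌈L⌉ : ℝ) := fun k => by
    have := (PiLp.norm_apply_le (toSpace i) k).trans (h1.trans (Int.le_ceil L))
    simpa [toSpace] using this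
  refine ⟨fun k => ?_, fun k => ?_⟩
  · have := (abs_le.mp (h2 k)).1
    exact_mod_cast this
  · have := (abs_le.mp (h2 k)).2
    exact_mod_cast this

/-- Translation invariance: for every `a`, the random fields `(X_{i+a})_i` and `(X_i)_i` have the
same law on `ℝ^(ℤ^d)` with the product σ-algebra. -/
def TranslationInvariant {Ω : Type*} [MeasurableSpace Ω] {d : ℕ}
    (X : (Fin d → ℤ) → Ω → ℝ) (P : Measure Ω) : Prop :=
  ∀ a : Fin d → ℤ, IdentDistrib (fun ω i => X (i + a) ω) (fun ω i => X i ω) P P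

/-- The correlation (intensity) function `ρ_k(i_1,…,i_k) = E[X_{i_1} ⋯ X_{i_k}]`; the `k` arguments
are labelled by a finite type `κ`, so that they may also be labelled by a block of a partition. -/
def corr {Ω : Type*} [MeasurableSpace Ω] {d : ℕ} (X : (Fin d → ℤ) → Ω → ℝ) (P : Measure Ω)
    {κ : Type*} [Fintype κ] (i : κ → Fin d → ℤ) : ℝ :=
  ∫ ω, ∏ j, X (i j) ω ∂P

/-- The truncated correlation function
`ρ_k^T(i_1,…,i_k) = ∑_π (|π|-1)! (-1)^(|π|-1) ∏_{B ∈ π} ρ_{|B|}(i_j : j ∈ B)`, where `π` runs over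
all partitions of the set of `k` labels. -/
def truncCorr {Ω : Type*} [MeasurableSpace Ω] {d : ℕ} (X : (Fin d → ℤ) → Ω → ℝ) (P : Measure Ω)
    {k : ℕ} (i : Fin k → Fin d → ℤ) : ℝ :=
  ∑ π : Finpartition (Finset.univ : Finset (Fin k)),
    ((π.parts.card - 1).factorial : ℝ) * (-1) ^ (π.parts.card - 1) *
      ∏ B ∈ π.parts, corr X P (fun j : B => i j)

/-- The summability condition on the truncated correlation functions: for every `k = n + 1 ≥ 1`,
`sup_{i_1} ∑_{i_2,…,i_k} ρ_k^T(i_1,…,i_k) < ∞`, the sums over `(ℤ^d)^(k-1)` being convergent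
(unconditionally, hence absolutely). -/
def SummableTruncCorr {Ω : Type*} [MeasurableSpace Ω] {d : ℕ} (X : (Fin d → ℤ) → Ω → ℝ)
    (P : Measure Ω) : Prop :=
  ∀ n : ℕ,
    (∀ i₁ : Fin d → ℤ, Summable fun t : Fin n → Fin d → ℤ =>
      truncCorr X P (Fin.cons i₁ t : Fin (n + 1) → Fin d → ℤ)) ∧
    BddAbove (Set.range fun i₁ : Fin d → ℤ => ∑' t : Fin n → Fin d → ℤ,
      truncCorr X P (Fin.cons i₁ t : Fin (n + 1) → Fin d → ℤ))

end LatticeField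

end

open scoped Finset Topology Nat

namespace LatticeField

/-! By multilinearity, the `n`-th cumulant of a sum over a finite set of sites is a sum of truncated
correlations. Summability and translation invariance bound it by a constant times the number of
sites (`exists_abs_cumulantOf_sum_le`), hence by a multiple of `L ^ d` on the ball. If the variance
grows at least like `L`, the normalised cumulants are `O(L ^ (d - n / 2))` and vanish in the limit
for `n > 2 * d`.

The orders from 3 to `2 * d` are settled by an asymptotic form of Marcinkiewicz's theorem
(`tendsto_cumulant_zero`): a law whose cumulants vanish from some order on is normal or degenerate.
Only a family of inequalities between moments, `ExpPositive`, is used; these survive pointwise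
limits of moment sequences, so no limiting law has to be constructed. The cumulants thus tend to
those of the normal law, hence so do the moments, and the method of moments
(`tendstoInDistribution_of_moments`) concludes.

The linear variance bound comes from geometry. By a Bessel inequality (`sum_sq_le_integral_sq`), the
variance dominates a multiple of the sum of squared covariances of `Q` with any finite set of single
sites. Near suitable boundary sites the ball looks like a half-space `p ⬝ᵥ v ≤ h` within a fixed
window. For well-chosen `p`, the half-spaces with `h = 0` and `h = -1` differ there by the origin
alone, so their covariance sums differ by `ρ 0 = 1` and one of them is at least `1/2` in absolute
value (`exists_halfSpace_sum`). Since `d ≥ 2`, linearly many such sites exist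
(`exists_many_halfSpace_windows`). -/

/-! ### Cumulants and partitions -/

/-- The weight `(r-1)! (-1)^(r-1)` of a partition with `r` blocks. -/
def blockWeight (r : ℕ) : ℝ := ((r - 1).factorial : ℝ) * (-1) ^ (r - 1)

/-- The cumulant of a set function, as a signed sum over partitions. -/
def setCumulant {α : Type*} [DecidableEq α] (m : Finset α → ℝ) (S : Finset α) : ℝ :=
  ∑ π : Finpartition S, blockWeight #π.parts * ∏ B ∈ π.parts, m B

/-- The cancellation behind the moment-cumulant recursion: an `r`-block partition counts once for
itself and once for each of the `r - 1` blocks avoiding a marked point, which can be split off. -/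
theorem blockWeight_add (r : ℕ) (hr : 1 < r) :
    blockWeight r + ((r - 1 : ℕ) : ℝ) * blockWeight (r - 1) = 0 := by
  obtain ⟨n, rfl⟩ := Nat.exists_eq_add_of_lt hr
  simp only [blockWeight, show 1 + n + 1 - 1 = n + 1 by omega, Nat.add_sub_cancel,
    Nat.factorial_succ]
  push_cast
  ring

section Partitions

variable {α : Type*} [DecidableEq α] {S T : Finset α} {x : α}

theorem disjoint_insert_sdiff (hx : x ∉ S) : Disjoint (insert x T) (S \ T) := by
  rw [Finset.disjoint_left]
  intro a ha ha'
  grind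

theorem insert_sup_sdiff (hT : T ⊆ S) : insert x T ⊔ (S \ T) = insert x S := by
  ext a
  simp only [Finset.sup_eq_union, Finset.mem_union, Finset.mem_insert, Finset.mem_sdiff]
  grind

/-- Adjoin the block `S \ T` to a partition of `insert x T`. -/
def extendCompl (hx : x ∉ S) (hT : T ⊂ S) (π : Finpartition (insert x T)) :
    Finpartition (insert x S) :=
  π.extend (b := S \ T) (by simpa using hT.2) (disjoint_insert_sdiff hx)
    (insert_sup_sdiff hT.1)

theorem extendCompl_parts (hx : x ∉ S) (hT : T ⊂ S) (π : Finpartition (insert x T)) :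
    (extendCompl hx hT π).parts = insert (S \ T) π.parts := rfl

theorem sdiff_notMem_parts (hx : x ∉ S) (π : Finpartition (insert x T)) :
    S \ T ∉ π.parts := by
  intro h
  obtain ⟨a, ha⟩ := π.nonempty_of_mem_parts h
  exact Finset.disjoint_left.1 (disjoint_insert_sdiff hx) (π.subset h ha) ha

theorem card_filter_notMem (σ : Finpartition S) (hx : x ∈ S) :
    #{C ∈ σ.parts | x ∉ C} = #σ.parts - 1 := by
  have : {C ∈ σ.parts | x ∉ C} = σ.parts.erase (σ.part x) := by
    ext C
    simp only [Finset.mem_filter, Finset.mem_erase]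
    constructor
    · rintro ⟨h1, h2⟩
      refine ⟨?_, h1⟩
      rintro rfl
      exact h2 (σ.mem_part_self.2 hx)
    · rintro ⟨h1, h2⟩
      exact ⟨h2, fun h => h1 (σ.part_eq_of_mem h2 h).symm⟩
  rw [this, Finset.card_erase_of_mem (σ.part_mem.2 hx)]

/-- Choosing `T` and a partition of `insert x T` amounts to choosing a partition of `insert x S`
with a distinguished block avoiding `x`, namely `S \ T`. -/
theorem sum_extendCompl (m : Finset α → ℝ) (hx : x ∉ S) :
    ∑ T ∈ S.ssubsets, setCumulant m (insert x T) * m (S \ T) =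
      ∑ σ : Finpartition (insert x S), ∑ C ∈ σ.parts with x ∉ C,
        blockWeight (#σ.parts - 1) * ∏ B ∈ σ.parts, m B := by
  simp only [setCumulant, Finset.sum_mul]
  rw [Finset.sum_sigma', Finset.sum_sigma']
  refine Finset.sum_bij
    (fun p hp => ⟨extendCompl hx (Finset.mem_ssubsets.1 (Finset.mem_sigma.1 hp).1) p.2,
      S \ p.1⟩) ?_ ?_ ?_ ?_
  · rintro ⟨T, π⟩ hp
    simp [extendCompl_parts, hx]
  · rintro ⟨T, π⟩ hp ⟨T', π'⟩ hp' h
    have hT : T ⊂ S := Finset.mem_ssubsets.1 (Finset.mem_sigma.1 hp).1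
    have hT' : T' ⊂ S := Finset.mem_ssubsets.1 (Finset.mem_sigma.1 hp').1
    simp only [Sigma.mk.injEq, heq_eq_eq] at h
    obtain ⟨h1, h2⟩ := h
    have hTT : T = T' := by
      rw [← Finset.sdiff_sdiff_eq_self hT.1, h2, Finset.sdiff_sdiff_eq_self hT'.1]
    subst hTT
    have h3 := congrArg Finpartition.parts h1
    rw [extendCompl_parts, extendCompl_parts] at h3
    have h4 : π.parts = π'.parts := by
      rw [← Finset.erase_insert (sdiff_notMem_parts hx π), h3,
        Finset.erase_insert (sdiff_notMem_parts hx π')]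
    rw [Finpartition.ext h4]
  · rintro ⟨σ, C⟩ hp
    simp only [Finset.mem_sigma, Finset.mem_univ, Finset.mem_filter, true_and] at hp
    obtain ⟨hC, hxC⟩ := hp
    have hCS : C ⊆ S := fun a ha => by
      have := σ.subset hC ha
      grind
    have hne := σ.nonempty_of_mem_parts hC
    have hss : S \ C ⊂ S := Finset.sdiff_ssubset hCS hne
    have heq : insert x S \ C = insert x (S \ C) := by
      rw [Finset.insert_sdiff_of_notMem _ hxC]
    refine ⟨⟨S \ C, (σ.avoid C).copy heq⟩, by simpa using hss, ?_⟩
    have hsd : S \ (S \ C) = C := Finset.sdiff_sdiff_eq_self hCS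
    have hpar : (extendCompl hx hss ((σ.avoid C).copy heq)).parts = σ.parts := by
      rw [extendCompl_parts, hsd]
      ext D
      rw [Finset.mem_insert, show ((σ.avoid C).copy heq).parts = (σ.avoid C).parts from rfl,
        Finpartition.mem_avoid]
      constructor
      · rintro (rfl | ⟨E, hE, hEC, rfl⟩)
        · exact hC
        · have hne : E ≠ C := fun h => hEC h.le
          have : Disjoint E C := σ.disjoint hE hC hne
          rwa [Finset.sdiff_eq_self_of_disjoint this]
      · intro hD
        by_cases h : D = C
        · exact Or.inl h
        · have hd : Disjoint D C := σ.disjoint hD hC h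
          refine Or.inr ⟨D, hD, fun hle => ?_, Finset.sdiff_eq_self_of_disjoint hd⟩
          obtain ⟨a, ha⟩ := σ.nonempty_of_mem_parts hD
          exact Finset.disjoint_left.1 hd ha (hle ha)
    simp only [Sigma.mk.injEq, heq_eq_eq]
    exact ⟨Finpartition.ext hpar, hsd⟩
  · rintro ⟨T, π⟩ hp
    have hT := Finset.mem_ssubsets.1 (Finset.mem_sigma.1 hp).1
    have hn := sdiff_notMem_parts hx π
    simp only [extendCompl_parts]
    rw [Finset.card_insert_of_notMem hn, Finset.prod_insert hn, Nat.add_sub_cancel]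
    ring

/-- The moment-cumulant recursion, splitting off the block containing `x`. -/
theorem moment_eq_sum_setCumulant (m : Finset α → ℝ) (hm : m ∅ = 1) (hx : x ∉ S) :
    m (insert x S) = ∑ T ∈ S.powerset, setCumulant m (insert x T) * m (S \ T) := by
  have h1 : S.powerset = insert S S.ssubsets := by
    ext T
    simp only [Finset.mem_powerset, Finset.mem_insert, Finset.mem_ssubsets]
    exact ⟨fun h => (eq_or_ssubset_of_subset h), by rintro (rfl | h); exacts [subset_rfl, h.1]⟩
  rw [h1, Finset.sum_insert (by simp), sum_extendCompl m hx, Finset.sdiff_self, hm, mul_one,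
    setCumulant, ← Finset.sum_add_distrib]
  have hxS : x ∈ insert x S := Finset.mem_insert_self _ _
  have hne : (insert x S : Finset α) ≠ ⊥ := Finset.insert_ne_empty _ _
  -- By `blockWeight_add` every partition with at least two blocks cancels, which leaves the
  -- one-block partition.
  rw [Finset.sum_eq_single (Finpartition.indiscrete hne)]
  · rw [Finset.sum_const, card_filter_notMem _ hxS]
    simp [blockWeight]
  · intro σ _ hσ
    rw [Finset.sum_const, card_filter_notMem _ hxS, nsmul_eq_mul, ← mul_assoc, ← add_mul,
      blockWeight_add, zero_mul]
    by_contra! hle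
    apply hσ
    obtain ⟨B, hB⟩ := Finset.card_eq_one.1
      (le_antisymm hle (Finset.card_pos.2 (σ.parts_nonempty hne)))
    have hs := σ.sup_parts
    rw [hB, Finset.sup_singleton] at hs
    refine Finpartition.ext ?_
    rw [hB, Finpartition.indiscrete_parts, ← hs]
    rfl
  · simp

end Partitions

/-- The moment sequence with prescribed cumulants. -/
def momentOf (c : ℕ → ℝ) : ℕ → ℝ
  | 0 => 1
  | n + 1 => ∑ k : Fin (n + 1), (n.choose k : ℝ) * c (k + 1) * momentOf c (n - k)

/-- The cumulants of a moment sequence. -/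
def cumulantOf (m : ℕ → ℝ) : ℕ → ℝ
  | 0 => 0
  | n + 1 => m (n + 1) - ∑ k : Fin n, (n.choose k : ℝ) * cumulantOf m (k + 1) * m (n - k)

theorem momentOf_succ (c : ℕ → ℝ) (n : ℕ) :
    momentOf c (n + 1) =
      ∑ k ∈ Finset.range (n + 1), (n.choose k : ℝ) * c (k + 1) * momentOf c (n - k) := by
  rw [momentOf, Finset.sum_range fun k => (n.choose k : ℝ) * c (k + 1) * momentOf c (n - k)]

theorem cumulantOf_succ (m : ℕ → ℝ) (n : ℕ) :
    cumulantOf m (n + 1) = m (n + 1) -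
      ∑ k ∈ Finset.range n, (n.choose k : ℝ) * cumulantOf m (k + 1) * m (n - k) := by
  rw [cumulantOf, Finset.sum_range fun k => (n.choose k : ℝ) * cumulantOf m (k + 1) * m (n - k)]

theorem moment_succ_eq_sum (m : ℕ → ℝ) (hm : m 0 = 1) (n : ℕ) :
    m (n + 1) = ∑ k ∈ Finset.range (n + 1),
      (n.choose k : ℝ) * cumulantOf m (k + 1) * m (n - k) := by
  rw [Finset.sum_range_succ, cumulantOf_succ]
  simp [hm]

theorem momentOf_cumulantOf (m : ℕ → ℝ) (hm : m 0 = 1) : momentOf (cumulantOf m) = m := by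
  funext n
  induction n using Nat.strong_induction_on with
  | _ n ih =>
    cases n with
    | zero => rw [momentOf, hm]
    | succ n =>
      rw [momentOf_succ, moment_succ_eq_sum m hm]
      exact Finset.sum_congr rfl fun k _ => by rw [ih (n - k) (by omega)]

theorem cumulantOf_mul_pow (m : ℕ → ℝ) (a : ℝ) (n : ℕ) :
    cumulantOf (fun j => a ^ j * m j) n = a ^ n * cumulantOf m n := by
  induction n using Nat.strong_induction_on with
  | _ n ih =>
    cases n with
    | zero => simp [cumulantOf]
    | succ n =>
      rw [cumulantOf_succ, cumulantOf_succ, mul_sub, Finset.mul_sum]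
      congr 1
      refine Finset.sum_congr rfl fun k hk => ?_
      have hk := Finset.mem_range.1 hk
      have hp : a ^ (n + 1) = a ^ (k + 1) * a ^ (n - k) := by
        rw [← pow_add]
        congr 1
        omega
      rw [ih (k + 1) (by omega), hp]
      ring

/-- When moments depend only on cardinality, the set recursion groups by `#T` into the binomial
recursion. The empty set must be excluded: its `setCumulant` is 1, while `cumulantOf f 0` is 0. -/
theorem setCumulant_eq_cumulantOf {α : Type*} [DecidableEq α] (m : Finset α → ℝ) (f : ℕ → ℝ)
    (hf : f 0 = 1) (hm : ∀ S, m S = f #S) (S : Finset α) (hS : S.Nonempty) :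
    setCumulant m S = cumulantOf f #S := by
  induction h : #S using Nat.strong_induction_on generalizing S with
  | _ N ih =>
    obtain ⟨x, hx⟩ := hS
    obtain ⟨S, hxS, rfl⟩ : ∃ T, x ∉ T ∧ S = insert x T :=
      ⟨S.erase x, by simp, (Finset.insert_erase hx).symm⟩
    have h0 : m ∅ = 1 := by simp [hm, hf]
    have hr := moment_eq_sum_setCumulant m h0 hxS
    have hc : #(insert x S) = #S + 1 := Finset.card_insert_of_notMem hxS
    obtain rfl : N = #S + 1 := by omega
    have h1 : S.powerset = insert S S.ssubsets := by
      ext T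
      simp only [Finset.mem_powerset, Finset.mem_insert, Finset.mem_ssubsets]
      exact ⟨fun h => (eq_or_ssubset_of_subset h), by rintro (rfl | h); exacts [subset_rfl, h.1]⟩
    have h2 : ∑ T ∈ S.ssubsets, setCumulant m (insert x T) * m (S \ T) =
        ∑ T ∈ S.ssubsets, cumulantOf f (#T + 1) * f (#S - #T) := by
      refine Finset.sum_congr rfl fun T hT => ?_
      have hT := Finset.mem_ssubsets.1 hT
      have hcT : #(insert x T) = #T + 1 := Finset.card_insert_of_notMem fun h => hxS (hT.1 h)
      have := Finset.card_lt_card hT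
      rw [ih (#T + 1) (by omega) (insert x T) (Finset.insert_nonempty _ _) hcT, hm,
        Finset.card_sdiff_of_subset hT.1]
    have h3 := Finset.sum_powerset_apply_card (fun k => cumulantOf f (k + 1) * f (#S - k)) (x := S)
    rw [h1, Finset.sum_insert (by simp), h2] at hr
    rw [h1, Finset.sum_insert (by simp)] at h3
    have h4 := moment_succ_eq_sum f hf #S
    rw [hm, hc] at hr
    simp only [nsmul_eq_mul, ← mul_assoc] at h3
    rw [← h4] at h3
    simp only [Finset.sdiff_self, Nat.sub_self, h0, hf] at hr h3
    linarith

/-! ### Exponential generating functions -/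

/-- The cumulant generating polynomial, the sum of `c_n z^n / n!` over `1 ≤ n ≤ s`. -/
noncomputable def cumulantPoly (c : ℕ → ℝ) (s : ℕ) (z : ℂ) : ℂ :=
  ∑ n ∈ Finset.range s, (c (n + 1) : ℂ) / ((n + 1).factorial : ℂ) * z ^ (n + 1)

/-- The derivative of the cumulant generating polynomial. -/
noncomputable def cumulantPolyDeriv (c : ℕ → ℝ) (s : ℕ) (z : ℂ) : ℂ :=
  ∑ n ∈ Finset.range s, (c (n + 1) : ℂ) / (n.factorial : ℂ) * z ^ n

theorem hasDerivAt_cumulantPoly (c : ℕ → ℝ) (s : ℕ) (z : ℂ) :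
    HasDerivAt (cumulantPoly c s) (cumulantPolyDeriv c s z) z := by
  unfold cumulantPoly cumulantPolyDeriv
  refine HasDerivAt.fun_sum fun n _ => ?_
  have h := (hasDerivAt_pow (n + 1) z).const_mul ((c (n + 1) : ℂ) / ((n + 1).factorial : ℂ))
  refine h.congr_deriv ?_
  have h1 : (n.factorial : ℂ) ≠ 0 := by exact_mod_cast n.factorial_ne_zero
  have h2 : ((n : ℂ) + 1) ≠ 0 := by exact_mod_cast n.succ_ne_zero
  rw [Nat.factorial_succ]
  push_cast
  field_simp

theorem contDiff_cumulantPolyDeriv (c : ℕ → ℝ) (s : ℕ) {n : WithTop ℕ∞} :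
    ContDiff ℂ n (cumulantPolyDeriv c s) := by
  unfold cumulantPolyDeriv
  fun_prop

theorem contDiff_cumulantPoly (c : ℕ → ℝ) (s : ℕ) {n : WithTop ℕ∞} :
    ContDiff ℂ n (cumulantPoly c s) := by
  unfold cumulantPoly
  fun_prop

theorem iteratedDeriv_cumulantPolyDeriv (c : ℕ → ℝ) (s : ℕ) (hc : ∀ k, s < k → c k = 0) (k : ℕ) :
    iteratedDeriv k (cumulantPolyDeriv c s) 0 = c (k + 1) := by
  unfold cumulantPolyDeriv
  rw [iteratedDeriv_fun_sum fun n _ => by fun_prop]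
  simp only [iteratedDeriv_const_mul_field, iteratedDeriv_fun_pow_zero, Nat.cast_ite,
    Nat.cast_zero, mul_ite, mul_zero]
  rw [Finset.sum_ite_eq]
  split_ifs with h
  · have h1 : (k.factorial : ℂ) ≠ 0 := by exact_mod_cast k.factorial_ne_zero
    field_simp
  · rw [hc (k + 1) (by simp at h; omega)]
    simp

/-- With `K` the cumulant polynomial, Leibniz's rule applied to `(exp K)' = K' exp K` at 0 is the
recursion defining `momentOf`. -/
theorem iteratedDeriv_exp_cumulantPoly (c : ℕ → ℝ) (s : ℕ) (hc : ∀ k, s < k → c k = 0) (n : ℕ) :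
    iteratedDeriv n (fun z => Complex.exp (cumulantPoly c s z)) 0 = momentOf c n := by
  induction n using Nat.strong_induction_on with
  | _ n ih =>
    cases n with
    | zero => simp [momentOf, cumulantPoly]
    | succ n =>
      have hd : deriv (fun z => Complex.exp (cumulantPoly c s z)) =
          fun z => cumulantPolyDeriv c s z * Complex.exp (cumulantPoly c s z) := by
        funext z
        rw [((hasDerivAt_cumulantPoly c s z).cexp).deriv, mul_comm]
      have he : ContDiff ℂ n fun z => Complex.exp (cumulantPoly c s z) :=
        (contDiff_cumulantPoly c s).cexp
      rw [iteratedDeriv_succ', hd, iteratedDeriv_fun_mul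
        (contDiff_cumulantPolyDeriv c s).contDiffAt he.contDiffAt, momentOf_succ]
      push_cast
      refine Finset.sum_congr rfl fun k _ => ?_
      rw [ih (n - k) (by omega), iteratedDeriv_cumulantPolyDeriv c s hc]

theorem hasSum_momentOf (c : ℕ → ℝ) (s : ℕ) (hc : ∀ k, s < k → c k = 0) (z : ℂ) :
    HasSum (fun n : ℕ => (momentOf c n : ℂ) * (z ^ n / (n.factorial : ℂ)))
      (Complex.exp (cumulantPoly c s z)) := by
  have hf : Differentiable ℂ fun z => Complex.exp (cumulantPoly c s z) :=
    fun z => ((hasDerivAt_cumulantPoly c s z).cexp).differentiableAt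
  have h := Complex.hasSum_taylorSeries_of_entire hf 0 z
  simp only [iteratedDeriv_exp_cumulantPoly c s hc, sub_zero, smul_eq_mul] at h
  convert! h using 2
  ring

/-- The form `∑_{j,k<N} a^j/j! b^k/k! m_{j+k}`. -/
noncomputable def momentForm (m : ℕ → ℝ) (N : ℕ) (a b : ℂ) : ℂ :=
  ∑ j ∈ Finset.range N, ∑ k ∈ Finset.range N,
    (m (j + k) : ℂ) * (a ^ j / (j.factorial : ℂ) * (b ^ k / (k.factorial : ℂ)))

theorem sum_antidiagonal_moment (m : ℕ → ℝ) (a b : ℂ) (n : ℕ) :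
    ∑ p ∈ Finset.HasAntidiagonal.antidiagonal n, (m (p.1 + p.2) : ℂ) *
        (a ^ p.1 / (p.1.factorial : ℂ) * (b ^ p.2 / (p.2.factorial : ℂ))) =
      (m n : ℂ) * ((a + b) ^ n / (n.factorial : ℂ)) := by
  rw [(Commute.all a b).add_pow', Finset.sum_div, Finset.mul_sum]
  refine Finset.sum_congr rfl fun p hp => ?_
  have hp := Finset.HasAntidiagonal.mem_antidiagonal.1 hp
  have h1 : (p.1.factorial : ℂ) ≠ 0 := by exact_mod_cast p.1.factorial_ne_zero
  have h2 : (p.2.factorial : ℂ) ≠ 0 := by exact_mod_cast p.2.factorial_ne_zero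
  have h3 : (n.factorial : ℂ) ≠ 0 := by exact_mod_cast n.factorial_ne_zero
  have h4 : ((n.choose p.1 : ℕ) : ℂ) * (p.1.factorial : ℂ) * (p.2.factorial : ℂ) =
      (n.factorial : ℂ) := by
    rw [show p.2 = n - p.1 by omega]
    exact_mod_cast Nat.choose_mul_factorial_mul_factorial (show p.1 ≤ n by omega)
  rw [hp, nsmul_eq_mul]
  field_simp
  rw [← h4]
  ring

/-- Along antidiagonals the binomial theorem collapses the double series to powers of `a + b`.
Applied to absolute values, it also gives absolute convergence, so summing over squares is
legitimate. -/
theorem tendsto_momentForm (m : ℕ → ℝ)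
    (hm : ∀ z : ℂ, Summable fun n : ℕ => (m n : ℂ) * (z ^ n / (n.factorial : ℂ))) (a b : ℂ) :
    Tendsto (fun N => momentForm m N a b) atTop
      (𝓝 (∑' n : ℕ, (m n : ℂ) * ((a + b) ^ n / (n.factorial : ℂ)))) := by
  set F : ℕ × ℕ → ℂ := fun p => (m (p.1 + p.2) : ℂ) *
    (a ^ p.1 / (p.1.factorial : ℂ) * (b ^ p.2 / (p.2.factorial : ℂ))) with hF
  have hnorm : ∀ p, ‖F p‖ = (|m (p.1 + p.2)|) *
      (‖a‖ ^ p.1 / (p.1.factorial : ℝ) * (‖b‖ ^ p.2 / (p.2.factorial : ℝ))) := by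
    intro p
    simp [hF]
  have hs : Summable F := by
    rw [← summable_norm_iff,
      ← (Finset.HasAntidiagonal.sigmaAntidiagonalEquivProd (A := ℕ)).summable_iff]
    refine (summable_sigma_of_nonneg fun _ => norm_nonneg _).2 ⟨fun n => Summable.of_finite, ?_⟩
    have h1 := (hm ((‖a‖ + ‖b‖ : ℝ) : ℂ)).norm
    refine h1.congr fun n => ?_
    have h2 := sum_antidiagonal_moment (fun n => |m n|) (‖a‖ : ℂ) (‖b‖ : ℂ) n
    rw [tsum_fintype]
    simp only [Finset.HasAntidiagonal.sigmaAntidiagonalEquivProd_apply]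
    rw [Finset.sum_coe_sort (Finset.HasAntidiagonal.antidiagonal n) fun p => ‖F p‖]
    simp only [hnorm]
    have h3 : (∑ p ∈ Finset.HasAntidiagonal.antidiagonal n, |m (p.1 + p.2)| *
        (‖a‖ ^ p.1 / (p.1.factorial : ℝ) * (‖b‖ ^ p.2 / (p.2.factorial : ℝ)))) =
        |m n| * ((‖a‖ + ‖b‖) ^ n / (n.factorial : ℝ)) := by
      exact_mod_cast h2
    rw [h3, norm_mul, norm_div, norm_pow, Complex.norm_real, Complex.norm_real, Real.norm_eq_abs,
      Real.norm_of_nonneg (add_nonneg (norm_nonneg a) (norm_nonneg b))]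
    simp
  have htsum : ∑' n : ℕ, (m n : ℂ) * ((a + b) ^ n / (n.factorial : ℂ)) = ∑' p, F p := by
    have hs' := hs
    rw [← (Finset.HasAntidiagonal.sigmaAntidiagonalEquivProd (A := ℕ)).summable_iff] at hs'
    rw [← (Finset.HasAntidiagonal.sigmaAntidiagonalEquivProd (A := ℕ)).tsum_eq F]
    have h5 := hs'.tsum_sigma' fun n => Summable.of_finite
    simp only [Function.comp_def] at h5
    rw [h5]
    refine tsum_congr fun n => ?_
    rw [← sum_antidiagonal_moment, tsum_fintype]
    simp only [Finset.HasAntidiagonal.sigmaAntidiagonalEquivProd_apply]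
    rw [Finset.sum_coe_sort (Finset.HasAntidiagonal.antidiagonal n) F]
  rw [htsum]
  have hlim : Tendsto (fun N => Finset.range N ×ˢ Finset.range N) atTop
      (atTop : Filter (Finset (ℕ × ℕ))) := by
    refine tendsto_atTop_finset_of_monotone (fun i j hij =>
      Finset.product_subset_product (Finset.range_mono hij) (Finset.range_mono hij)) ?_
    rintro ⟨j, k⟩
    exact ⟨max j k + 1, by simp⟩
  refine (hs.hasSum.comp hlim).congr fun N => ?_
  simp only [Function.comp_def, momentForm, hF]
  rw [Finset.sum_product]

/-- The positivity property of moment sequences used below: `|E[p(Y)^2]| ≤ E|p(Y)|^2` for the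
Taylor polynomials `p` of exponentials. -/
def ExpPositive (m : ℕ → ℝ) : Prop :=
  ∀ (N : ℕ) (a : ℂ), ‖momentForm m N a a‖ ≤ ‖momentForm m N a (starRingEnd ℂ a)‖

theorem ExpPositive.mul_pow {m : ℕ → ℝ} (h : ExpPositive m) (t : ℝ) :
    ExpPositive fun n => t ^ n * m n := by
  have key : ∀ N a b, momentForm (fun n => t ^ n * m n) N a b = momentForm m N (t * a) (t * b) := by
    intro N a b
    unfold momentForm
    refine Finset.sum_congr rfl fun j _ => Finset.sum_congr rfl fun k _ => ?_
    push_cast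
    ring
  intro N a
  rw [key, key]
  have := h N (t * a)
  rwa [map_mul, Complex.conj_ofReal] at this

/-- Each instance of the inequality involves finitely many moments, so it is a closed condition. -/
theorem ExpPositive.of_tendsto {ι : Type*} {l : Filter ι} [l.NeBot] {m : ι → ℕ → ℝ} {m' : ℕ → ℝ}
    (h : ∀ i, ExpPositive (m i)) (hm : ∀ n, Tendsto (fun i => m i n) l (𝓝 (m' n))) :
    ExpPositive m' := by
  intro N a
  have key : ∀ b, Tendsto (fun i => momentForm (m i) N a b) l (𝓝 (momentForm m' N a b)) := by
    intro b
    unfold momentForm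
    refine tendsto_finsetSum _ fun j _ => tendsto_finsetSum _ fun k _ => ?_
    exact ((Complex.continuous_ofReal.tendsto _).comp (hm (j + k))).mul_const _
  exact le_of_tendsto_of_tendsto (key _).norm (key _).norm (Eventually.of_forall fun i => h i N a)

/-- Since `Y` is real, conjugating `a` conjugates the Taylor polynomial evaluated at `Y`; the claim
is then the triangle inequality for integrals. -/
theorem expPositive_moments {Ω : Type*} [MeasurableSpace Ω] (P : Measure Ω) (Y : Ω → ℝ)
    (hY : ∀ n : ℕ, Integrable (fun ω => Y ω ^ n) P) : ExpPositive fun n => ∫ ω, Y ω ^ n ∂P := by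
  have hYC : ∀ n : ℕ, Integrable (fun ω => (Y ω : ℂ) ^ n) P := fun n => by
    simpa using (hY n).ofReal (𝕜 := ℂ)
  intro N a
  set p : ℂ → Ω → ℂ := fun b ω => ∑ j ∈ Finset.range N, b ^ j / (j.factorial : ℂ) * (Y ω : ℂ) ^ j
    with hp
  have hpp : ∀ b ω, p a ω * p b ω = ∑ j ∈ Finset.range N, ∑ k ∈ Finset.range N,
      (Y ω : ℂ) ^ (j + k) * (a ^ j / (j.factorial : ℂ) * (b ^ k / (k.factorial : ℂ))) := by
    intro b ω
    simp only [hp, Finset.sum_mul_sum]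
    refine Finset.sum_congr rfl fun j _ => Finset.sum_congr rfl fun k _ => ?_
    ring
  have key : ∀ b, momentForm (fun n => ∫ ω, Y ω ^ n ∂P) N a b = ∫ ω, p a ω * p b ω ∂P := by
    intro b
    simp only [hpp]
    rw [integral_finsetSum _ fun j _ => integrable_finsetSum _ fun k _ => (hYC _).mul_const _]
    unfold momentForm
    refine Finset.sum_congr rfl fun j _ => ?_
    rw [integral_finsetSum _ fun k _ => (hYC _).mul_const _]
    refine Finset.sum_congr rfl fun k _ => ?_
    rw [integral_mul_const]
    congr 1
    rw [← integral_complex_ofReal]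
    simp
  have hconj : ∀ ω, p (starRingEnd ℂ a) ω = starRingEnd ℂ (p a ω) := by
    intro ω
    simp [hp]
  rw [key, key]
  have h2 : ∫ ω, p a ω * p (starRingEnd ℂ a) ω ∂P = ((∫ ω, ‖p a ω‖ ^ 2 ∂P : ℝ) : ℂ) := by
    rw [← integral_complex_ofReal]
    refine integral_congr_ae (Eventually.of_forall fun ω => ?_)
    simp only [hconj, Complex.mul_conj']
    push_cast
    rfl
  rw [h2, Complex.norm_real, Real.norm_of_nonneg (integral_nonneg fun _ => by positivity)]
  refine (norm_integral_le_integral_norm _).trans_eq ?_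
  simp only [norm_mul, sq]

/-! ### Marcinkiewicz's theorem and convergence of cumulants -/

/-- The ridge property `|exp K(z)| ≤ |exp K(Re z)|`, obtained from `ExpPositive` at `a = z / 2` as
`N → ∞`. -/
theorem re_cumulantPoly_le (c : ℕ → ℝ) (s : ℕ) (hc : ∀ k, s < k → c k = 0)
    (hpos : ExpPositive (momentOf c)) (z : ℂ) :
    (cumulantPoly c s z).re ≤ (cumulantPoly c s (z.re : ℂ)).re := by
  have hm := fun z => (hasSum_momentOf c s hc z).summable
  have key : ∀ a b, Tendsto (fun N => momentForm (momentOf c) N a b) atTop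
      (𝓝 (Complex.exp (cumulantPoly c s (a + b)))) := by
    intro a b
    have h := tendsto_momentForm (momentOf c) hm a b
    rwa [(hasSum_momentOf c s hc (a + b)).tsum_eq] at h
  have h := le_of_tendsto_of_tendsto (key (z / 2) (z / 2)).norm
    (key (z / 2) (starRingEnd ℂ (z / 2))).norm (Eventually.of_forall fun N => hpos N (z / 2))
  have h2 : z / 2 + starRingEnd ℂ (z / 2) = (z.re : ℂ) := by
    rw [Complex.add_conj]
    simp
    ring
  rw [add_halves, h2, Complex.norm_exp, Complex.norm_exp, Real.exp_le_exp] at h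
  exact h

theorem leading_coeff_nonpos (b : ℕ → ℝ) (D : ℕ)
    (h : ∀ r : ℝ, 0 < r → ∑ n ∈ Finset.range (D + 1), b n * r ^ (n + 1) ≤ 0) : b D ≤ 0 := by
  have hlim : Tendsto (fun r : ℝ => ∑ n ∈ Finset.range (D + 1), b n * (r⁻¹) ^ (D - n)) atTop
      (𝓝 (∑ n ∈ Finset.range (D + 1), b n * 0 ^ (D - n))) :=
    tendsto_finsetSum _ fun n _ => (tendsto_inv_atTop_zero.pow _).const_mul _
  have h0 : ∑ n ∈ Finset.range (D + 1), b n * (0 : ℝ) ^ (D - n) = b D := by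
    rw [Finset.sum_range_succ, Finset.sum_eq_zero]
    · simp
    · intro n hn
      have := Finset.mem_range.1 hn
      rw [zero_pow (by omega), mul_zero]
  rw [h0] at hlim
  refine le_of_tendsto hlim ((eventually_gt_atTop 0).mono fun r hr => ?_)
  have h1 : ∑ n ∈ Finset.range (D + 1), b n * (r⁻¹) ^ (D - n) =
      (∑ n ∈ Finset.range (D + 1), b n * r ^ (n + 1)) * (r⁻¹) ^ (D + 1) := by
    rw [Finset.sum_mul]
    refine Finset.sum_congr rfl fun n hn => ?_
    have := Finset.mem_range.1 hn
    have h2 : (r⁻¹) ^ (D + 1) = (r⁻¹) ^ (n + 1) * (r⁻¹) ^ (D - n) := by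
      rw [← pow_add]
      congr 1
      omega
    rw [h2, mul_assoc, ← mul_assoc (r ^ (n + 1)), ← mul_pow, mul_inv_cancel₀ hr.ne', one_pow,
      one_mul]
  rw [h1]
  exact mul_nonpos_of_nonpos_of_nonneg (h r hr) (by positivity)

/-- **Marcinkiewicz's theorem** for the leading cumulant. -/
theorem leading_cumulant_eq_zero (c : ℕ → ℝ) (D : ℕ) (hD : 2 ≤ D)
    (hc : ∀ k, D + 1 < k → c k = 0) (hpos : ExpPositive (momentOf c)) : c (D + 1) = 0 := by
  -- The leading coefficient in `r` of the ridge inequality along the ray `z = r e^{iθ}`.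
  have key : ∀ θ : ℝ, c (D + 1) *
      (Real.cos ((D + 1 : ℕ) * θ) - Real.cos θ ^ (D + 1)) ≤ 0 := by
    intro θ
    have h := leading_coeff_nonpos (fun n => c (n + 1) / ((n + 1).factorial : ℝ) *
      (Real.cos ((n + 1 : ℕ) * θ) - Real.cos θ ^ (n + 1))) D fun r hr => by
        have h1 := re_cumulantPoly_le c (D + 1) hc hpos (r * Complex.exp (θ * Complex.I))
        have h2 : ((r : ℂ) * Complex.exp (θ * Complex.I)).re = r * Real.cos θ := by
          rw [Complex.re_ofReal_mul, Complex.exp_ofReal_mul_I_re]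
        rw [h2] at h1
        unfold cumulantPoly at h1
        rw [Complex.re_sum, Complex.re_sum, ← sub_nonpos, ← Finset.sum_sub_distrib] at h1
        refine le_trans (le_of_eq (Finset.sum_congr rfl fun n _ => ?_)) h1
        have h3 : ∀ w : ℂ, ((c (n + 1) : ℂ) / ((n + 1).factorial : ℂ) * w).re =
            c (n + 1) / ((n + 1).factorial : ℝ) * w.re := by
          intro w
          rw [show (c (n + 1) : ℂ) / ((n + 1).factorial : ℂ) =
            ((c (n + 1) / ((n + 1).factorial : ℝ) : ℝ) : ℂ) by push_cast; rfl,
            Complex.re_ofReal_mul]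
        have h4 : (((r : ℂ) * Complex.exp (θ * Complex.I)) ^ (n + 1)).re =
            r ^ (n + 1) * Real.cos ((n + 1 : ℕ) * θ) := by
          rw [mul_pow, ← Complex.exp_nat_mul, ← Complex.ofReal_pow, Complex.re_ofReal_mul,
            ← mul_assoc, show ((n + 1 : ℕ) : ℂ) * (θ : ℂ) = (((n + 1 : ℕ) * θ : ℝ) : ℂ) by
              push_cast; rfl, Complex.exp_ofReal_mul_I_re]
        rw [h3, h3, h4, ← Complex.ofReal_pow, Complex.ofReal_re]
        ring
    have hf : (0 : ℝ) < ((D + 1).factorial : ℝ) := by exact_mod_cast (D + 1).factorial_pos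
    rw [div_mul_eq_mul_div, div_le_iff₀ hf, zero_mul] at h
    exact h
  have hD' : (3 : ℝ) ≤ ((D + 1 : ℕ) : ℝ) := by exact_mod_cast (by omega : 3 ≤ D + 1)
  have hpi := Real.pi_pos
  have hD0 : (0 : ℝ) < ((D + 1 : ℕ) : ℝ) := by linarith
  refine le_antisymm ?_ ?_
  -- Here the bracket is `1 - cos θ ^ (D + 1) > 0`. Strictness needs `D + 1 ≥ 3`: in degree 2 the
  -- angle would be `π` and the bracket 0.
  · have h := key (2 * Real.pi / (D + 1 : ℕ))
    rw [mul_div_cancel₀ _ hD0.ne', Real.cos_two_pi] at h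
    have hlt : |Real.cos (2 * Real.pi / (D + 1 : ℕ))| < 1 := by
      rw [abs_lt]
      have hx0 : 0 < 2 * Real.pi / (D + 1 : ℕ) := by positivity
      have hx1 : 2 * Real.pi / (D + 1 : ℕ) < Real.pi := by
        rw [div_lt_iff₀ hD0]
        nlinarith
      constructor
      · rw [← Real.cos_pi]
        exact Real.cos_lt_cos_of_nonneg_of_le_pi hx0.le le_rfl hx1
      · rw [← Real.cos_zero]
        exact Real.cos_lt_cos_of_nonneg_of_le_pi le_rfl hx1.le hx0
    have hlt2 : Real.cos (2 * Real.pi / (D + 1 : ℕ)) ^ (D + 1) < 1 := by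
      refine lt_of_le_of_lt (le_abs_self _) ?_
      rw [abs_pow]
      exact pow_lt_one₀ (abs_nonneg _) hlt (by omega)
    nlinarith
  -- Here the bracket is at most `-1`, which gives the opposite sign.
  · have h := key (Real.pi / (D + 1 : ℕ))
    rw [mul_div_cancel₀ _ hD0.ne', Real.cos_pi] at h
    have hge : 0 ≤ Real.cos (Real.pi / (D + 1 : ℕ)) := by
      refine Real.cos_nonneg_of_mem_Icc ⟨?_, ?_⟩
      · have : 0 < Real.pi / (D + 1 : ℕ) := by positivity
        linarith
      · exact div_le_div_of_nonneg_left hpi.le (by norm_num) (by linarith)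
    have := pow_nonneg hge (D + 1)
    nlinarith

theorem cumulant_eq_zero_of_expPositive (c : ℕ → ℝ) (s : ℕ) (hc : ∀ k, s < k → c k = 0)
    (hpos : ExpPositive (momentOf c)) (k : ℕ) (hk : 3 ≤ k) : c k = 0 := by
  induction s with
  | zero => exact hc k (by omega)
  | succ s ih =>
    by_cases hs : 2 ≤ s
    · refine ih fun j hj => ?_
      rcases Nat.lt_or_ge (s + 1) j with h | h
      · exact hc j h
      · obtain rfl : j = s + 1 := by omega
        exact leading_cumulant_eq_zero c s hs hc hpos
    · exact hc k (by omega)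

theorem tendsto_momentOf {ι : Type*} {l : Filter ι} {c : ι → ℕ → ℝ} {d : ℕ → ℝ}
    (h : ∀ n, 1 ≤ n → Tendsto (fun i => c i n) l (𝓝 (d n))) (n : ℕ) :
    Tendsto (fun i => momentOf (c i) n) l (𝓝 (momentOf d n)) := by
  induction n using Nat.strong_induction_on with
  | _ n ih =>
    cases n with
    | zero => simpa [momentOf] using tendsto_const_nhds
    | succ n =>
      simp only [momentOf_succ]
      exact tendsto_finsetSum _ fun k _ =>
        ((h (k + 1) (by omega)).const_mul _).mul (ih (n - k) (by omega))

/-- If bounded cumulants of exponentially positive moment sequences tend to zero from some order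
on, then they tend to zero from order three on. -/
theorem tendsto_zero_of_bounded {ι : Type*} {l : Filter ι} (c : ι → ℕ → ℝ)
    (hpos : ∀ i, ExpPositive (momentOf (c i))) (s : ℕ)
    (hbdd : ∀ n, 1 ≤ n → n ≤ s → ∀ᶠ i in l, |c i n| ≤ 1)
    (hs : ∀ n, s < n → Tendsto (fun i => c i n) l (𝓝 0)) (n : ℕ) (hn : 3 ≤ n) :
    Tendsto (fun i => c i n) l (𝓝 0) := by
  -- Along an ultrafilter bounded cumulants converge, so compactness needs no subsequences; the
  -- limiting cumulants vanish from order three by `cumulant_eq_zero_of_expPositive`.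
  rw [tendsto_iff_ultrafilter]
  intro U hU
  have hex : ∀ k, ∃ d : ℝ, (1 ≤ k → Tendsto (fun i => c i k) U (𝓝 d)) ∧ (s < k → d = 0) := by
    intro k
    rcases Nat.lt_or_ge s k with h | h
    · exact ⟨0, fun _ => (hs k h).mono_left hU, fun _ => rfl⟩
    · rcases Nat.eq_zero_or_pos k with rfl | hk
      · exact ⟨0, by omega, by omega⟩
      · have hmem : ∀ᶠ i in (U : Filter ι), c i k ∈ Set.Icc (-1 : ℝ) 1 :=
          Eventually.mono (Filter.Eventually.filter_mono hU (hbdd k hk h)) fun i hi => abs_le.1 hi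
        obtain ⟨d, -, hd⟩ := isCompact_Icc.ultrafilter_le_nhds (U.map fun i => c i k)
          (by rw [Ultrafilter.coe_map, le_principal_iff]; exact hmem)
        exact ⟨d, fun _ => hd, by omega⟩
  choose d hd hd0 using hex
  have hposd : ExpPositive (momentOf d) :=
    ExpPositive.of_tendsto (l := (U : Filter ι)) hpos fun k => tendsto_momentOf hd k
  have := hd n (by omega)
  rwa [cumulant_eq_zero_of_expPositive d s (fun k hk => hd0 k hk) hposd n hn] at this

/-- If the cumulants of large order tend to zero, while the first two are bounded by one, then all
cumulants from order three on tend to zero. -/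
theorem tendsto_cumulant_zero {ι : Type*} {l : Filter ι} (m : ι → ℕ → ℝ) (hm0 : ∀ i, m i 0 = 1)
    (hpos : ∀ i, ExpPositive (m i)) (s : ℕ)
    (h1 : ∀ᶠ i in l, |cumulantOf (m i) 1| ≤ 1) (h2 : ∀ᶠ i in l, |cumulantOf (m i) 2| ≤ 1)
    (hs : ∀ n, s < n → Tendsto (fun i => cumulantOf (m i) n) l (𝓝 0)) (n : ℕ) (hn : 3 ≤ n) :
    Tendsto (fun i => cumulantOf (m i) n) l (𝓝 0) := by
  set c : ι → ℕ → ℝ := fun i => cumulantOf (m i) with hc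
  set q : ι → ℕ → ℝ := fun i j => |c i j| ^ ((j : ℝ)⁻¹) with hq
  -- No bound on the middle cumulants is known, so the variable is divided by `lam`, which dominates
  -- every `|c_j| ^ (1/j)` with `2 < j ≤ s` and so brings those cumulants into `[-1, 1]`.
  set lam : ι → ℝ := fun i => 1 + ∑ j ∈ Finset.Ioc 2 s, q i j with hlam
  have hq0 : ∀ i j, 0 ≤ q i j := fun i j => Real.rpow_nonneg (abs_nonneg _) _
  have hqpow : ∀ i j, j ≠ 0 → q i j ^ j = |c i j| := fun i j hj =>
    Real.rpow_inv_natCast_pow (abs_nonneg _) hj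
  have hl1 : ∀ i, 1 ≤ lam i := fun i => by
    have := Finset.sum_nonneg fun j (_ : j ∈ Finset.Ioc 2 s) => hq0 i j
    simp only [hlam]
    linarith
  have hl0 : ∀ i, 0 < lam i := fun i => lt_of_lt_of_le one_pos (hl1 i)
  have hqle : ∀ i, ∀ j ∈ Finset.Ioc 2 s, q i j ≤ lam i := fun i j hj => by
    have := Finset.single_le_sum (fun j _ => hq0 i j) hj
    simp only [hlam]
    linarith
  set mu : ι → ℝ := fun i => (lam i)⁻¹ with hmu
  have hmu0 : ∀ i, 0 ≤ mu i := fun i => inv_nonneg.2 (hl0 i).le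
  have hmu1 : ∀ i, mu i ≤ 1 := fun i => inv_le_one_of_one_le₀ (hl1 i)
  have hscale : ∀ i, cumulantOf (fun k => mu i ^ k * m i k) = fun k => mu i ^ k * c i k :=
    fun i => funext fun k => cumulantOf_mul_pow (m i) (mu i) k
  have hsmall : ∀ i k, |mu i ^ k * c i k| ≤ |c i k| := fun i k => by
    rw [abs_mul, abs_of_nonneg (pow_nonneg (hmu0 i) k)]
    exact mul_le_of_le_one_left (abs_nonneg _) (pow_le_one₀ (hmu0 i) (hmu1 i))
  have habs : ∀ i k, k ≠ 0 → |mu i ^ k * c i k| = (mu i * q i k) ^ k := fun i k hk => by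
    rw [abs_mul, abs_of_nonneg (pow_nonneg (hmu0 i) k), mul_pow, hqpow i k hk]
  have hmain : ∀ k, 3 ≤ k → Tendsto (fun i => mu i ^ k * c i k) l (𝓝 0) := by
    refine tendsto_zero_of_bounded (fun i k => mu i ^ k * c i k) (fun i => ?_) (s + 2) ?_ ?_
    · have := (hpos i).mul_pow (mu i)
      rwa [← momentOf_cumulantOf (fun k => mu i ^ k * m i k) (by simp [hm0]), hscale] at this
    · intro k hk1 hk2
      rcases Nat.lt_or_ge k 3 with h | h
      · obtain rfl | rfl : k = 1 ∨ k = 2 := by omega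
        · exact h1.mono fun i hi => (hsmall i 1).trans hi
        · exact h2.mono fun i hi => (hsmall i 2).trans hi
      · rcases Nat.lt_or_ge s k with h' | h'
        · have := (hs k h').abs
          rw [abs_zero] at this
          exact (this.eventually_le_const one_pos).mono fun i hi => (hsmall i k).trans hi
        · refine Eventually.of_forall fun i => ?_
          rw [habs i k (by omega)]
          refine pow_le_one₀ (mul_nonneg (hmu0 i) (hq0 i k)) ?_
          rw [hmu, inv_mul_le_one₀ (hl0 i)]
          exact hqle i k (Finset.mem_Ioc.2 ⟨h, h'⟩)
    · intro k hk
      exact squeeze_zero_norm (fun i => hsmall i k) (by simpa using (hs k (by omega)).abs)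
  have hmq : ∀ k, 3 ≤ k → Tendsto (fun i => mu i * q i k) l (𝓝 0) := by
    intro k hk
    have h := ((hmain k hk).abs).rpow_const (p := (k : ℝ)⁻¹)
      (Or.inr (inv_nonneg.2 (Nat.cast_nonneg k)))
    rw [abs_zero, Real.zero_rpow (inv_ne_zero (by exact_mod_cast (by omega : k ≠ 0)))] at h
    refine h.congr fun i => ?_
    rw [habs i k (by omega), Real.pow_rpow_inv_natCast (mul_nonneg (hmu0 i) (hq0 i k)) (by omega)]
  -- The identity `mu * (1 + ∑ q_j) = 1` with `mu * q_j → 0` shows that the rescaling was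
  -- asymptotically trivial, so it can be undone.
  have hmu_lim : Tendsto mu l (𝓝 1) := by
    have h : Tendsto (fun i => 1 - ∑ j ∈ Finset.Ioc 2 s, mu i * q i j) l
        (𝓝 (1 - ∑ j ∈ Finset.Ioc 2 s, 0)) :=
      tendsto_const_nhds.sub (tendsto_finsetSum _ fun j hj =>
        hmq j (by have := (Finset.mem_Ioc.1 hj).1; omega))
    rw [Finset.sum_const_zero, sub_zero] at h
    refine h.congr fun i => ?_
    have h3 : mu i * lam i = 1 := inv_mul_cancel₀ (hl0 i).ne'
    rw [← Finset.mul_sum]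
    simp only [hlam, mul_add, mul_one] at h3
    linarith
  have hlast := (hmain n hn).mul ((hmu_lim.pow n).inv₀ (by simp))
  rw [zero_mul] at hlast
  refine hlast.congr fun i => ?_
  have : mu i ^ n ≠ 0 := pow_ne_zero _ (inv_ne_zero (hl0 i).ne')
  rw [mul_comm (mu i ^ n), mul_inv_cancel_right₀ this]

/-! ### The method of moments for the normal law -/

/-- The Taylor remainder of `x ↦ e^{ix}`. -/
noncomputable def expRemainder (n : ℕ) (x : ℝ) : ℂ :=
  Complex.exp (x * Complex.I) - ∑ k ∈ Finset.range n, (x * Complex.I) ^ k / (k.factorial : ℂ)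

theorem hasDerivAt_expRemainder (n : ℕ) (x : ℝ) :
    HasDerivAt (expRemainder (n + 1)) (Complex.I * expRemainder n x) x := by
  have hx : HasDerivAt (fun y : ℝ => (y : ℂ) * Complex.I) Complex.I x := by
    simpa using (Complex.ofRealCLM.hasDerivAt (x := x)).mul_const Complex.I
  have h1 := hx.cexp
  have h2 : HasDerivAt (fun y : ℝ => ∑ k ∈ Finset.range n,
      ((y : ℂ) * Complex.I) ^ (k + 1) / ((k + 1).factorial : ℂ))
      (∑ k ∈ Finset.range n, Complex.I * (((x : ℂ) * Complex.I) ^ k / (k.factorial : ℂ))) x := by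
    refine HasDerivAt.fun_sum fun k _ => ?_
    refine ((hx.fun_pow (k + 1)).div_const ((k + 1).factorial : ℂ)).congr_deriv ?_
    have h3 : (k.factorial : ℂ) ≠ 0 := by exact_mod_cast k.factorial_ne_zero
    have h4 : ((k : ℂ) + 1) ≠ 0 := by exact_mod_cast k.succ_ne_zero
    rw [Nat.factorial_succ]
    push_cast
    field_simp
  have h5 := (h1.sub h2).sub_const 1
  refine (h5.congr_deriv ?_).congr_of_eventuallyEq (Eventually.of_forall fun y => ?_)
  · rw [expRemainder, mul_sub, Finset.mul_sum, mul_comm]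
  · simp only [expRemainder, Finset.sum_range_succ', Pi.sub_apply]
    simp
    ring

theorem norm_expRemainder_le_of_nonneg (n : ℕ) (x : ℝ) (hx : 0 ≤ x) :
    ‖expRemainder n x‖ ≤ x ^ n / (n.factorial : ℝ) := by
  induction n generalizing x with
  | zero => simp [expRemainder, Complex.norm_exp_ofReal_mul_I]
  | succ n ih =>
    have hB : ∀ y : ℝ, HasDerivAt (fun y : ℝ => y ^ (n + 1) / ((n + 1).factorial : ℝ))
        (y ^ n / (n.factorial : ℝ)) y := by
      intro y
      refine ((hasDerivAt_pow (n + 1) y).div_const _).congr_deriv ?_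
      have h3 : (n.factorial : ℝ) ≠ 0 := by exact_mod_cast n.factorial_ne_zero
      have h4 : ((n : ℝ) + 1) ≠ 0 := by exact_mod_cast n.succ_ne_zero
      rw [Nat.factorial_succ]
      push_cast
      field_simp
    refine image_norm_le_of_norm_deriv_right_le_deriv_boundary (a := 0) (b := x)
      (f := expRemainder (n + 1)) (f' := fun y => Complex.I * expRemainder n y)
      (fun y _ => (hasDerivAt_expRemainder n y).continuousAt.continuousWithinAt)
      (fun y _ => (hasDerivAt_expRemainder n y).hasDerivWithinAt) ?_ hB ?_ ⟨hx, le_rfl⟩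
    · simp [expRemainder, Finset.sum_range_succ']
    · intro y hy
      rw [norm_mul, Complex.norm_I, one_mul]
      exact ih y hy.1

theorem norm_expRemainder_le (n : ℕ) (x : ℝ) :
    ‖expRemainder n x‖ ≤ |x| ^ n / (n.factorial : ℝ) := by
  rcases le_total 0 x with hx | hx
  · rw [abs_of_nonneg hx]
    exact norm_expRemainder_le_of_nonneg n x hx
  · have h : expRemainder n x = starRingEnd ℂ (expRemainder n (-x)) := by
      simp [expRemainder, ← Complex.exp_conj]
    rw [h, RCLike.norm_conj, abs_of_nonpos hx]
    exact norm_expRemainder_le_of_nonneg n (-x) (by linarith)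

/-- The cumulants of the standard normal law. -/
def normalCumulant (n : ℕ) : ℝ := if n = 2 then 1 else 0

theorem cumulantPoly_normal (t : ℝ) :
    cumulantPoly normalCumulant 2 (t * Complex.I) = -((t : ℂ) ^ 2) / 2 := by
  simp [cumulantPoly, normalCumulant, Finset.sum_range_succ, mul_pow]
  ring

/-- Truncating at the even order `2 * n` makes the error bound a moment instead of an absolute
moment. -/
theorem charFun_sub_sum_le {Ω : Type*} [MeasurableSpace Ω] (P : Measure Ω) [IsProbabilityMeasure P]
    (Y : Ω → ℝ) (hYm : AEMeasurable Y P) (hY : ∀ n : ℕ, Integrable (fun ω => Y ω ^ n) P)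
    (t : ℝ) (n : ℕ) :
    ‖charFun (P.map Y) t - ∑ k ∈ Finset.range (2 * n),
        ((∫ ω, Y ω ^ k ∂P : ℝ) : ℂ) * ((t * Complex.I) ^ k / (k.factorial : ℂ))‖ ≤
      |t| ^ (2 * n) / ((2 * n).factorial : ℝ) * ∫ ω, Y ω ^ (2 * n) ∂P := by
  have hYC : ∀ n : ℕ, Integrable (fun ω => (Y ω : ℂ) ^ n) P := fun n => by
    simpa using (hY n).ofReal (𝕜 := ℂ)
  have hexp : Integrable (fun ω => Complex.exp ((t * Y ω : ℝ) * Complex.I)) P := by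
    refine (integrable_const (1 : ℝ)).mono' ?_ (Eventually.of_forall fun ω => ?_)
    · have : AEMeasurable (fun ω => Complex.exp ((t * Y ω : ℝ) * Complex.I)) P := by fun_prop
      exact this.aestronglyMeasurable
    · rw [Complex.norm_exp_ofReal_mul_I]
  have h1 : charFun (P.map Y) t = ∫ ω, Complex.exp ((t * Y ω : ℝ) * Complex.I) ∂P := by
    rw [charFun_apply_real, integral_map hYm (by fun_prop)]
    simp
  have hint : ∀ k ∈ Finset.range (2 * n), Integrable (fun ω =>
      (((t * Y ω : ℝ) : ℂ) * Complex.I) ^ k / (k.factorial : ℂ)) P := by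
    intro k _
    have : (fun ω => (((t * Y ω : ℝ) : ℂ) * Complex.I) ^ k / (k.factorial : ℂ)) =
        fun ω => (Y ω : ℂ) ^ k * ((t * Complex.I) ^ k / (k.factorial : ℂ)) := by
      funext ω
      push_cast
      ring
    rw [this]
    exact (hYC k).mul_const _
  have h2 : ∑ k ∈ Finset.range (2 * n),
        ((∫ ω, Y ω ^ k ∂P : ℝ) : ℂ) * ((t * Complex.I) ^ k / (k.factorial : ℂ)) =
      ∫ ω, ∑ k ∈ Finset.range (2 * n),
        (((t * Y ω : ℝ) : ℂ) * Complex.I) ^ k / (k.factorial : ℂ) ∂P := by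
    rw [integral_finsetSum _ hint]
    refine Finset.sum_congr rfl fun k _ => ?_
    rw [← integral_complex_ofReal, ← integral_mul_const]
    refine integral_congr_ae (Eventually.of_forall fun ω => ?_)
    push_cast
    ring
  rw [h1, h2, ← integral_sub hexp (integrable_finsetSum _ hint), ← integral_const_mul]
  refine norm_integral_le_of_norm_le ((hY (2 * n)).const_mul _) (Eventually.of_forall fun ω => ?_)
  refine (norm_expRemainder_le (2 * n) (t * Y ω)).trans_eq ?_
  rw [abs_mul, mul_pow, Even.pow_abs (even_two_mul n) (Y ω)]
  ring

theorem tendsto_charFun_of_moments {Ω : Type*} [MeasurableSpace Ω] (P : Measure Ω)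
    [IsProbabilityMeasure P] {ι : Type*} {l : Filter ι} (Y : ι → Ω → ℝ)
    (hYm : ∀ i, AEMeasurable (Y i) P) (hY : ∀ i (n : ℕ), Integrable (fun ω => Y i ω ^ n) P)
    (h : ∀ n, Tendsto (fun i => ∫ ω, Y i ω ^ n ∂P) l (𝓝 (momentOf normalCumulant n))) (t : ℝ) :
    Tendsto (fun i => charFun (P.map (Y i)) t) l (𝓝 (charFun (gaussianReal 0 1) t)) := by
  have hg : charFun (gaussianReal 0 1) t =
      Complex.exp (cumulantPoly normalCumulant 2 (t * Complex.I)) := by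
    rw [charFun_gaussianReal, cumulantPoly_normal]
    simp
    ring_nf
  have hc : ∀ k, 2 < k → normalCumulant k = 0 := fun k hk => if_neg (by omega)
  have hsum := hasSum_momentOf normalCumulant 2 hc (t * Complex.I)
  have htwo : Tendsto (fun n : ℕ => 2 * n) atTop atTop :=
    tendsto_id.const_mul_atTop' (by norm_num)
  have hA := hsum.tendsto_sum_nat.comp htwo
  -- The limiting error bound is the norm of a term of the convergent series `hsum`; one `n` can
  -- thus be fixed before passing to the limit in `i`.
  have hB : Tendsto (fun n : ℕ => |t| ^ (2 * n) / ((2 * n).factorial : ℝ) *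
      momentOf normalCumulant (2 * n)) atTop (𝓝 0) := by
    have h3 := hsum.summable.tendsto_atTop_zero.norm.comp htwo
    rw [norm_zero] at h3
    refine squeeze_zero_norm (fun n => le_of_eq ?_) h3
    simp only [Function.comp_def, norm_mul, norm_div, norm_pow, Complex.norm_real,
      Real.norm_eq_abs, abs_abs, Complex.norm_I, mul_one, Complex.norm_natCast, Nat.abs_cast]
    ring
  rw [hg, Metric.tendsto_nhds]
  intro ε hε
  obtain ⟨n, hn1, hn2⟩ := ((Metric.tendsto_nhds.1 hA (ε / 3) (by positivity)).and
    (hB.eventually_lt_const (show (0 : ℝ) < ε / 3 by positivity))).exists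
  have hC : Tendsto (fun i => |t| ^ (2 * n) / ((2 * n).factorial : ℝ) * ∫ ω, Y i ω ^ (2 * n) ∂P) l
      (𝓝 (|t| ^ (2 * n) / ((2 * n).factorial : ℝ) * momentOf normalCumulant (2 * n))) :=
    (h (2 * n)).const_mul _
  have hD : Tendsto (fun i => ∑ k ∈ Finset.range (2 * n),
      ((∫ ω, Y i ω ^ k ∂P : ℝ) : ℂ) * ((t * Complex.I) ^ k / (k.factorial : ℂ))) l
      (𝓝 (∑ k ∈ Finset.range (2 * n),
        (momentOf normalCumulant k : ℂ) * ((t * Complex.I) ^ k / (k.factorial : ℂ)))) :=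
    tendsto_finsetSum _ fun k _ =>
      ((Complex.continuous_ofReal.tendsto _).comp (h k)).mul_const _
  filter_upwards [hC.eventually_lt_const hn2,
    Metric.tendsto_nhds.1 hD (ε / 3) (by positivity)] with i hi1 hi2
  have h4 := charFun_sub_sum_le P (Y i) (hYm i) (hY i) t n
  rw [← dist_eq_norm] at h4
  have h5 := dist_triangle4 (charFun (P.map (Y i)) t) (∑ k ∈ Finset.range (2 * n),
      ((∫ ω, Y i ω ^ k ∂P : ℝ) : ℂ) * ((t * Complex.I) ^ k / (k.factorial : ℂ)))
      (∑ k ∈ Finset.range (2 * n),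
        (momentOf normalCumulant k : ℂ) * ((t * Complex.I) ^ k / (k.factorial : ℂ)))
      (Complex.exp (cumulantPoly normalCumulant 2 (t * Complex.I)))
  simp only [Function.comp_def] at hn1
  linarith

/-- Convergence of the moments to those of the standard normal law implies convergence in
distribution. -/
theorem tendstoInDistribution_of_moments {Ω : Type*} [MeasurableSpace Ω] (P : Measure Ω)
    [IsProbabilityMeasure P] {ι : Type*} {l : Filter ι} [l.IsCountablyGenerated] (Y : ι → Ω → ℝ)
    (hYm : ∀ i, AEMeasurable (Y i) P) (hY : ∀ i (n : ℕ), Integrable (fun ω => Y i ω ^ n) P)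
    (h : ∀ n, Tendsto (fun i => ∫ ω, Y i ω ^ n ∂P) l (𝓝 (momentOf normalCumulant n))) :
    TendstoInDistribution Y l (id : ℝ → ℝ) (fun _ => P) (gaussianReal 0 1) where
  forall_aemeasurable := hYm
  aemeasurable_limit := aemeasurable_id
  tendsto := by
    refine tendsto_of_seq_tendsto fun u hu => ?_
    refine ProbabilityMeasure.tendsto_iff_tendsto_charFun.2 fun t => ?_
    have hlim : Tendsto (fun k => charFun (P.map (Y (u k))) t) atTop
        (𝓝 (charFun ((gaussianReal 0 1).map id) t)) := by
      rw [Measure.map_id]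
      exact (tendsto_charFun_of_moments P Y hYm hY h t).comp hu
    exact hlim

/-! ### Cumulants of sums over finite sets of sites -/

section Moments

variable {Ω : Type*} [MeasurableSpace Ω] {P : Measure Ω}

/-- All moments of `f` are finite. -/
def HasAllMoments (f : Ω → ℝ) (P : Measure Ω) : Prop := ∀ p : ℕ, MemLp f p P

theorem HasAllMoments.mul {f g : Ω → ℝ} (hf : HasAllMoments f P) (hg : HasAllMoments g P) :
    HasAllMoments (fun ω => f ω * g ω) P := by
  intro p
  have : ENNReal.HolderTriple ((2 * p : ℕ) : ENNReal) ((2 * p : ℕ) : ENNReal) (p : ENNReal) := by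
    constructor
    push_cast
    rw [ENNReal.mul_inv (by simp) (by simp), ← add_mul, ENNReal.inv_two_add_inv_two, one_mul]
  exact (hg (2 * p)).mul (hf (2 * p))

theorem HasAllMoments.prod [IsProbabilityMeasure P] {κ : Type*} (s : Finset κ) {f : κ → Ω → ℝ}
    (hf : ∀ j, HasAllMoments (f j) P) : HasAllMoments (fun ω => ∏ j ∈ s, f j ω) P := by
  classical
  induction s using Finset.induction_on with
  | empty =>
    simp only [Finset.prod_empty]
    exact fun p => memLp_const 1
  | insert a s ha ih =>
    simp only [Finset.prod_insert ha]
    exact (hf a).mul ih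

theorem HasAllMoments.sum {κ : Type*} (s : Finset κ) {f : κ → Ω → ℝ}
    (hf : ∀ j, HasAllMoments (f j) P) : HasAllMoments (fun ω => ∑ j ∈ s, f j ω) P :=
  fun p => memLp_finsetSum s fun j _ => hf j p

theorem HasAllMoments.integrable {f : Ω → ℝ} (hf : HasAllMoments f P) : Integrable f P :=
  memLp_one_iff_integrable.1 (by simpa using hf 1)

theorem HasAllMoments.integrable_pow [IsProbabilityMeasure P] {f : Ω → ℝ}
    (hf : HasAllMoments f P) (n : ℕ) : Integrable (fun ω => f ω ^ n) P := by
  simpa using (HasAllMoments.prod (Finset.range n) fun _ => hf).integrable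

end Moments

section Correlations

variable {Ω : Type*} [MeasurableSpace Ω] {P : Measure Ω} {d : ℕ} {X : (Fin d → ℤ) → Ω → ℝ}

theorem TranslationInvariant.corr_add (hinv : TranslationInvariant X P) {κ : Type*} [Fintype κ]
    (i : κ → Fin d → ℤ) (a : Fin d → ℤ) : corr X P (fun j => i j + a) = corr X P i := by
  have hmeas : Measurable fun f : (Fin d → ℤ) → ℝ => ∏ j, f (i j) := by fun_prop
  exact ((hinv a).comp hmeas).integral_eq

theorem TranslationInvariant.truncCorr_add (hinv : TranslationInvariant X P) {k : ℕ}
    (i : Fin k → Fin d → ℤ) (a : Fin d → ℤ) :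
    truncCorr X P (fun j => i j + a) = truncCorr X P i := by
  unfold truncCorr
  refine Finset.sum_congr rfl fun π _ => ?_
  congr 1
  exact Finset.prod_congr rfl fun B _ => hinv.corr_add (fun j : B => i j) a

theorem truncCorr_eq_setCumulant {k : ℕ} (i : Fin k → Fin d → ℤ) :
    truncCorr X P i = setCumulant (fun B => ∫ ω, ∏ j ∈ B, X (i j) ω ∂P) Finset.univ := by
  unfold truncCorr setCumulant
  refine Finset.sum_congr rfl fun π _ => ?_
  rw [blockWeight]
  congr 1
  refine Finset.prod_congr rfl fun B _ => ?_
  unfold corr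
  congr 1
  funext ω
  exact Finset.prod_coe_sort B fun j => X (i j) ω

theorem truncCorr_pair [IsProbabilityMeasure P] (hmean : ∀ i, P[X i] = 0)
    (i : Fin 2 → Fin d → ℤ) : truncCorr X P i = ∫ ω, X (i 0) ω * X (i 1) ω ∂P := by
  have h := moment_eq_sum_setCumulant (S := {1}) (x := (0 : Fin 2))
    (fun B => ∫ ω, ∏ j ∈ B, X (i j) ω ∂P) (by simp) (by simp)
  have hS : (({1} : Finset (Fin 2)).powerset) = {∅, {1}} := by decide
  have h01 : (insert 0 {1} : Finset (Fin 2)) = Finset.univ := by decide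
  have hm1 : ∫ ω, X (i 1) ω ∂P = 0 := hmean (i 1)
  rw [hS, Finset.sum_pair (by decide)] at h
  simp only [Finset.sdiff_empty, Finset.prod_singleton, hm1, mul_zero, zero_add,
    Finset.sdiff_self, Finset.prod_empty, integral_const, probReal_univ, smul_eq_mul,
    mul_one, h01] at h
  rw [truncCorr_eq_setCumulant, ← h]
  simp [Fin.prod_univ_two]

theorem integral_sum_pow [IsProbabilityMeasure P] (hX : ∀ i, HasAllMoments (X i) P)
    (Λ : Finset (Fin d → ℤ)) {κ : Type*} [Fintype κ] [DecidableEq κ] :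
    ∫ ω, (∑ i ∈ Λ, X i ω) ^ Fintype.card κ ∂P = ∑ u : κ → Λ, corr X P fun j => (u j : Fin d → ℤ) := by
  unfold corr
  rw [← integral_finsetSum _ fun u _ => (HasAllMoments.prod _ fun j => hX _).integrable]
  congr 1
  funext ω
  rw [← Finset.sum_coe_sort Λ fun i => X i ω, ← Finset.card_univ, ← Finset.prod_const,
    Finset.prod_univ_sum, Fintype.piFinset_univ]

/-- A labelling of all indices is the same as an independent choice of labellings of the blocks, so
the sum factorises. -/
theorem sum_prod_corr (Λ : Finset (Fin d → ℤ)) {k : ℕ}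
    (π : Finpartition (Finset.univ : Finset (Fin k))) :
    ∑ i : Fin k → Λ, ∏ B ∈ π.parts, corr X P (fun j : B => (i j : Fin d → ℤ)) =
      ∏ B ∈ π.parts, ∑ u : B → Λ, corr X P (fun j => (u j : Fin d → ℤ)) := by
  rw [← Finset.prod_coe_sort π.parts fun B => ∑ u : B → Λ, corr X P fun j => (u j : Fin d → ℤ),
    Finset.prod_univ_sum, Fintype.piFinset_univ]
  refine Finset.sum_bij' (fun i _ B j => i j)
    (fun u _ j => u ⟨π.part j, π.part_mem.2 (Finset.mem_univ j)⟩
      ⟨j, π.mem_part_self.2 (Finset.mem_univ j)⟩) ?_ ?_ ?_ ?_ ?_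
  · exact fun _ _ => Finset.mem_univ _
  · exact fun _ _ => Finset.mem_univ _
  · exact fun _ _ => rfl
  · intro u _
    funext B j
    have key : ∀ (C : π.parts) (hj : (j : Fin k) ∈ (C : Finset (Fin k))),
        u C ⟨j, hj⟩ = u B j := by
      intro C hj
      obtain rfl : C = B := Subtype.ext (π.eq_of_mem_parts C.2 B.2 hj j.2)
      rfl
    exact key _ _
  · intro i _
    exact (Finset.prod_coe_sort π.parts fun B => corr X P fun j : B => (i j : Fin d → ℤ)).symm

/-- Multilinearity of the cumulants. -/
theorem cumulantOf_sum [IsProbabilityMeasure P] (hX : ∀ i, HasAllMoments (X i) P)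
    (Λ : Finset (Fin d → ℤ)) (n : ℕ) :
    cumulantOf (fun k => ∫ ω, (∑ i ∈ Λ, X i ω) ^ k ∂P) (n + 1) =
      ∑ i : Fin (n + 1) → Λ, truncCorr X P fun j => (i j : Fin d → ℤ) := by
  -- All `n + 1` labels carry the same variable, so moments depend only on the number of labels.
  have h := setCumulant_eq_cumulantOf
    (fun S : Finset (Fin (n + 1)) => ∫ ω, (∑ i ∈ Λ, X i ω) ^ #S ∂P)
    (fun k => ∫ ω, (∑ i ∈ Λ, X i ω) ^ k ∂P) (by simp) (fun _ => rfl) Finset.univ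
    Finset.univ_nonempty
  rw [Finset.card_univ, Fintype.card_fin] at h
  rw [← h, setCumulant]
  unfold truncCorr
  rw [Finset.sum_comm]
  refine Finset.sum_congr rfl fun π _ => ?_
  rw [← Finset.mul_sum, sum_prod_corr, blockWeight]
  congr 1
  refine Finset.prod_congr rfl fun B _ => ?_
  rw [← integral_sum_pow hX Λ, Fintype.card_coe]

/-- The cumulants of a sum over `Λ` grow at most linearly in the number of sites. -/
theorem exists_abs_cumulantOf_sum_le [IsProbabilityMeasure P] (hX : ∀ i, HasAllMoments (X i) P)
    (hinv : TranslationInvariant X P) (hsum : SummableTruncCorr X P) (n : ℕ) :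
    ∃ C : ℝ, 0 ≤ C ∧ ∀ Λ : Finset (Fin d → ℤ),
      |cumulantOf (fun k => ∫ ω, (∑ i ∈ Λ, X i ω) ^ k ∂P) (n + 1)| ≤ C * #Λ := by
  set g : (Fin d → ℤ) → (Fin n → Fin d → ℤ) → ℝ := fun a t =>
    |truncCorr X P (Fin.cons a t : Fin (n + 1) → Fin d → ℤ)| with hg
  have hgs : ∀ a, Summable (g a) := fun a => ((hsum n).1 a).abs
  have hshift : ∀ a t, g a t = g 0 (fun j => t j + -a) := by
    intro a t
    simp only [hg]
    rw [← hinv.truncCorr_add _ (-a)]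
    congr 2
    funext j
    refine Fin.cases ?_ (fun j => ?_) j <;> simp
  have htsum : ∀ a, ∑' t, g a t = ∑' t, g 0 t := by
    intro a
    rw [← (Equiv.arrowCongr (Equiv.refl (Fin n)) (Equiv.addRight (-a))).tsum_eq (g 0)]
    exact tsum_congr fun t => hshift a t
  -- By translation invariance the absolute sum based at the origin serves for every first site;
  -- each site of `Λ` contributes at most this much.
  refine ⟨∑' t, g 0 t, tsum_nonneg fun t => abs_nonneg _, fun Λ => ?_⟩
  rw [cumulantOf_sum hX]
  refine (Finset.abs_sum_le_sum_abs _ _).trans ?_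
  rw [← (Fin.consEquiv fun _ : Fin (n + 1) => Λ).sum_comp, Fintype.sum_prod_type]
  have hb : ∀ a : Λ, ∑ t : Fin n → Λ, |truncCorr X P fun j =>
      ((Fin.consEquiv (fun _ : Fin (n + 1) => Λ) (a, t) j : Λ) : Fin d → ℤ)| ≤ ∑' t, g 0 t := by
    intro a
    rw [← htsum a]
    have hinj : Function.Injective fun (t : Fin n → Λ) (j : Fin n) => (t j : Fin d → ℤ) := by
      intro t t' h
      funext j
      exact Subtype.ext (congrFun h j)
    have h1 := (hgs a).sum_le_tsum (Finset.univ.map ⟨_, hinj⟩) fun _ _ => abs_nonneg _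
    rw [Finset.sum_map] at h1
    refine le_trans (le_of_eq (Finset.sum_congr rfl fun t _ => ?_)) h1
    simp only [hg, Function.Embedding.coeFn_mk]
    congr 2
    funext j
    refine Fin.cases ?_ (fun j => ?_) j <;> simp [Fin.consEquiv]
  refine (Finset.sum_le_sum fun a _ => hb a).trans_eq ?_
  simp [mul_comm]

end Correlations

/-! ### Balls look like half-spaces near many of their boundary points -/

section Geometry

variable {d : ℕ}

theorem toSpace_mem_ball_iff (i : Fin d → ℤ) {L : ℝ} (hL : 0 ≤ L) :
    toSpace i ∈ ball d L ↔ ((i ⬝ᵥ i : ℤ) : ℝ) ≤ L ^ 2 := by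
  rw [ball, mem_closedBall_zero_iff, ← sq_le_sq₀ (norm_nonneg _) hL, EuclideanSpace.norm_sq_eq]
  simp [toSpace, dotProduct, sq]

/-- A vector of powers is orthogonal to no nonzero vector with small entries. -/
theorem eq_zero_of_dotProduct_powers {d : ℕ} (K : ℕ) (v : Fin d → ℤ) (hv : ∀ k, |v k| ≤ K)
    (h : (fun k : Fin d => ((K : ℤ) + 1) ^ (k : ℕ)) ⬝ᵥ v = 0) : v = 0 := by
  induction d with
  | zero => exact Subsingleton.elim _ _
  | succ d ih =>
    have hsplit : (fun k : Fin (d + 1) => ((K : ℤ) + 1) ^ (k : ℕ)) ⬝ᵥ v =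
        v 0 + ((K : ℤ) + 1) * ((fun k : Fin d => ((K : ℤ) + 1) ^ (k : ℕ)) ⬝ᵥ fun k => v k.succ) := by
      simp only [dotProduct, Fin.sum_univ_succ, Fin.val_zero, pow_zero, one_mul, Fin.val_succ,
        Finset.mul_sum]
      congr 1
      exact Finset.sum_congr rfl fun k _ => by ring
    rw [hsplit] at h
    -- Modulo `K + 1` only the first entry survives, and it is smaller than the modulus in absolute
    -- value.
    have h0 : v 0 = 0 := by
      refine Int.eq_zero_of_abs_lt_dvd (m := (K : ℤ) + 1) ?_ ?_
      · exact ⟨-((fun k : Fin d => ((K : ℤ) + 1) ^ (k : ℕ)) ⬝ᵥ fun k => v k.succ), by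
          rw [mul_neg]; linarith⟩
      · have := hv 0
        linarith
    rw [h0, zero_add] at h
    have h1 := ih (fun k => v k.succ) (fun k => hv k.succ)
      ((mul_eq_zero.1 h).resolve_left (by positivity))
    funext k
    refine Fin.cases h0 (fun k => ?_) k
    exact congrFun h1 k

/-- For `s = ⌊√(Z / q)⌋` the gap `Z - s² q` is below `(2s + 1) q`. Since `4 D s ≤ t` and `2 D ≤ t`,
this is at most `t`. -/
theorem exists_root_near (Z D t q : ℝ) (hZ : 0 ≤ Z) (hD : 0 < D) (hq : 1 ≤ q) (hqD : q ≤ D)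
    (ht : 2 * D ≤ t) (hZt : 16 * D ^ 2 * Z ≤ t ^ 2) :
    ∃ s : ℕ, (s : ℝ) ^ 2 * q ≤ Z ∧ Z - t < (s : ℝ) ^ 2 * q ∧ (2 * (s : ℝ) + 1) * D ≤ t := by
  have hq0 : 0 < q := by linarith
  refine ⟨⌊√(Z / q)⌋₊, ?_, ?_, ?_⟩
  all_goals
    have h1 := Nat.floor_le (Real.sqrt_nonneg (Z / q))
    have h2 := Nat.lt_floor_add_one (√(Z / q))
    have h3 : √(Z / q) ^ 2 = Z / q := Real.sq_sqrt (by positivity)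
    have h4 : √(Z / q) ^ 2 * q = Z := by rw [h3, div_mul_cancel₀ _ hq0.ne']
    set s : ℝ := (⌊√(Z / q)⌋₊ : ℝ)
    have hs0 : 0 ≤ s := Nat.cast_nonneg _
    set w := √(Z / q)
    have hw0 : 0 ≤ w := Real.sqrt_nonneg _
    have hwZ : w ^ 2 ≤ Z := by nlinarith [sq_nonneg w]
    have h5 : 4 * D * w ≤ t := by
      refine le_of_sq_le_sq ?_ (by linarith)
      nlinarith [sq_nonneg D]
  · nlinarith [pow_le_pow_left₀ hs0 h1 2]
  · have h6 : w ^ 2 < (s + 1) ^ 2 := pow_lt_pow_left₀ h2 hw0 (by norm_num)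
    have h7 : (2 * s + 1) * q ≤ t := by nlinarith
    nlinarith
  · nlinarith

/-- In the squared norm of `t p + s q + v`, the term `2 t (p ⬝ᵥ v)` moves in steps of `2 t`, while
`2 s (q ⬝ᵥ v) + v ⬝ᵥ v` is at most `t / 2` in absolute value. The base point is placed so that `L ^
2` separates the levels `h` and `h + 1`. -/
theorem ball_eq_halfSpace_near {p q v : Fin d → ℤ} (hpq : p ⬝ᵥ q = 0) (t s : ℕ) (h : ℤ) (A L : ℝ)
    (hqv : |((q ⬝ᵥ v : ℤ) : ℝ)| ≤ A) (hvv : ((v ⬝ᵥ v : ℤ) : ℝ) ≤ A)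
    (hs : (2 * (s : ℝ) + 1) * A ≤ t / 2)
    (h1 : (t : ℝ) ^ 2 * (p ⬝ᵥ p : ℤ) + (s : ℝ) ^ 2 * (q ⬝ᵥ q : ℤ) ≤ L ^ 2 - 2 * t * h - t / 2)
    (h2 : L ^ 2 - 2 * t * h - 3 * t / 2 <
      (t : ℝ) ^ 2 * (p ⬝ᵥ p : ℤ) + (s : ℝ) ^ 2 * (q ⬝ᵥ q : ℤ)) :
    ((((t : ℤ) • p + (s : ℤ) • q + v) ⬝ᵥ ((t : ℤ) • p + (s : ℤ) • q + v) : ℤ) : ℝ) ≤ L ^ 2 ↔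
      p ⬝ᵥ v ≤ h := by
  have hexp : ((t : ℤ) • p + (s : ℤ) • q + v) ⬝ᵥ ((t : ℤ) • p + (s : ℤ) • q + v) =
      (t : ℤ) ^ 2 * (p ⬝ᵥ p) + (s : ℤ) ^ 2 * (q ⬝ᵥ q) + 2 * t * (p ⬝ᵥ v) + 2 * s * (q ⬝ᵥ v) +
        v ⬝ᵥ v := by
    simp only [add_dotProduct, dotProduct_add, smul_dotProduct, dotProduct_smul, smul_eq_mul,
      dotProduct_comm q p, dotProduct_comm v p, dotProduct_comm v q, hpq]
    ring
  have hvv0 : (0 : ℝ) ≤ ((v ⬝ᵥ v : ℤ) : ℝ) := by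
    have : 0 ≤ v ⬝ᵥ v := Finset.sum_nonneg fun k _ => mul_self_nonneg (v k)
    exact_mod_cast this
  rw [hexp]
  push_cast
  obtain ⟨ha, hb⟩ := abs_le.1 hqv
  have hs0 : (0 : ℝ) ≤ s := Nat.cast_nonneg s
  have ht0 : (0 : ℝ) ≤ t := Nat.cast_nonneg t
  have hc : 2 * (s : ℝ) * ((q ⬝ᵥ v : ℤ) : ℝ) ≤ 2 * s * A := by nlinarith
  have hc' : -(2 * (s : ℝ) * A) ≤ 2 * (s : ℝ) * ((q ⬝ᵥ v : ℤ) : ℝ) := by nlinarith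
  constructor
  · intro hle
    by_contra! hlt
    have hlt' : (h : ℝ) + 1 ≤ ((p ⬝ᵥ v : ℤ) : ℝ) := by exact_mod_cast hlt
    have := mul_le_mul_of_nonneg_left hlt' (show 0 ≤ 2 * (t : ℝ) by positivity)
    nlinarith
  · intro hle
    have hle' : ((p ⬝ᵥ v : ℤ) : ℝ) ≤ h := by exact_mod_cast hle
    have := mul_le_mul_of_nonneg_left hle' (show 0 ≤ 2 * (t : ℝ) by positivity)
    nlinarith

theorem exists_shell_sites (Pn Qn A : ℝ) (hP1 : 1 ≤ Pn) (hQ1 : 1 ≤ Qn) (hA0 : 0 ≤ A) (h : ℤ)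
    (hh : h = 0 ∨ h = -1) :
    ∃ al be : ℝ, 0 < al ∧ al < be ∧ ∀ᶠ L : ℝ in atTop, ∀ t : ℕ, al * L ≤ t → (t : ℝ) ≤ be * L →
      ∃ s : ℕ, (2 * (s : ℝ) + 1) * (2 * A) ≤ t ∧
        (t : ℝ) ^ 2 * Pn + (s : ℝ) ^ 2 * Qn ≤ L ^ 2 - 2 * t * h - t / 2 ∧
        L ^ 2 - 2 * t * h - 3 * t / 2 < (t : ℝ) ^ 2 * Pn + (s : ℝ) ^ 2 * Qn := by
  obtain ⟨D, hD1, hQD, hAD⟩ : ∃ D : ℝ, 1 ≤ D ∧ Qn ≤ D ∧ 2 * A ≤ D :=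
    ⟨Qn + 2 * A, by linarith, by linarith, by linarith⟩
  -- `exists_root_near` needs the part of `L ^ 2` left for `s² Qn` to lie in `[0, e t²]`. The
  -- choices of `al` and `be` keep `L ^ 2 / t²` between `Pn + e / 4` and `Pn + 3 e / 4`; the
  -- remaining `e / 4` absorbs the terms linear in `t`.
  obtain ⟨e, he0, hDe⟩ : ∃ e : ℝ, 0 < e ∧ 16 * D ^ 2 * e = 1 :=
    ⟨1 / (16 * D ^ 2), by positivity, by field_simp⟩
  have hex : ∀ x : ℝ, 0 < x → ∃ y : ℝ, y = 1 / √x ∧ 0 < y ∧ y ^ 2 * x = 1 := fun x hx =>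
    ⟨1 / √x, rfl, by positivity, by
      rw [div_pow, Real.sq_sqrt hx.le, one_pow, one_div_mul_cancel hx.ne']⟩
  obtain ⟨al, hal, hal0, hal2⟩ := hex (Pn + 3 * e / 4) (by positivity)
  obtain ⟨be, hbe, hbe0, hbe2⟩ := hex (Pn + e / 4) (by positivity)
  have hlt : al < be := by
    rw [hal, hbe]
    exact one_div_lt_one_div_of_lt (Real.sqrt_pos.2 (by positivity))
      (Real.sqrt_lt_sqrt (by positivity) (by linarith))
  clear hal hbe hex
  refine ⟨al, be, hal0, hlt, ?_⟩
  filter_upwards [eventually_ge_atTop ((6 / e) / al), eventually_ge_atTop ((2 * D) / al),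
    eventually_gt_atTop 0] with L hL2 hL3 hL0 t ht1 ht2
  rw [div_le_iff₀ hal0] at hL2 hL3
  have ht0 : (0 : ℝ) < t := lt_of_lt_of_le (by positivity) ht1
  have hte : 6 ≤ e * t := by
    have : 6 / e ≤ t := by linarith
    rwa [div_le_iff₀' he0] at this
  have hte2 : 6 * (t : ℝ) ≤ e * (t : ℝ) ^ 2 := by
    have := mul_le_mul_of_nonneg_right hte ht0.le
    linarith
  have hlow : L ^ 2 ≤ (Pn + 3 * e / 4) * (t : ℝ) ^ 2 := by
    have h3 := pow_le_pow_left₀ (by positivity) ht1 2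
    have h4 := mul_le_mul_of_nonneg_left h3 (show 0 ≤ Pn + 3 * e / 4 by positivity)
    calc L ^ 2 = (al ^ 2 * (Pn + 3 * e / 4)) * L ^ 2 := by rw [hal2, one_mul]
      _ = (Pn + 3 * e / 4) * (al * L) ^ 2 := by ring
      _ ≤ _ := h4
  have hup : (Pn + e / 4) * (t : ℝ) ^ 2 ≤ L ^ 2 := by
    have h3 := pow_le_pow_left₀ ht0.le ht2 2
    have h4 := mul_le_mul_of_nonneg_left h3 (show 0 ≤ Pn + e / 4 by positivity)
    calc _ ≤ (Pn + e / 4) * (be * L) ^ 2 := h4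
      _ = (be ^ 2 * (Pn + e / 4)) * L ^ 2 := by ring
      _ = L ^ 2 := by rw [hbe2, one_mul]
  have hth : -(t : ℝ) ≤ t * h ∧ (t : ℝ) * h ≤ 0 := by
    rcases hh with rfl | rfl <;> constructor <;> push_cast <;> linarith
  have h5 : L ^ 2 - (t : ℝ) ^ 2 * Pn - 2 * (t * h) - t / 2 ≤ e * (t : ℝ) ^ 2 := by
    linarith [hth.1]
  have h6 : 0 ≤ L ^ 2 - (t : ℝ) ^ 2 * Pn - 2 * (t * h) - t / 2 := by linarith [hth.2]
  obtain ⟨s, hs1, hs2, hs3⟩ := exists_root_near _ D t Qn h6 (by linarith) hQ1 hQD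
    (by linarith) (by
      calc _ ≤ 16 * D ^ 2 * (e * (t : ℝ) ^ 2) := mul_le_mul_of_nonneg_left h5 (by positivity)
        _ = (t : ℝ) ^ 2 := by rw [← mul_assoc, hDe, one_mul])
  refine ⟨s, ?_, by linarith, by linarith⟩
  exact (mul_le_mul_of_nonneg_left hAD (by positivity)).trans hs3

/-- Linearly many translates of the window `W` see the ball of radius `L` as a half-space. -/
theorem exists_many_halfSpace_windows {p q : Fin d → ℤ} (hpq : p ⬝ᵥ q = 0) (hp : 1 ≤ p ⬝ᵥ p)
    (hq : 1 ≤ q ⬝ᵥ q) (W : Finset (Fin d → ℤ)) (h : ℤ) (hh : h = 0 ∨ h = -1) :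
    ∃ c : ℝ, 0 < c ∧ ∀ᶠ L : ℝ in atTop, ∃ J : Finset (Fin d → ℤ), c * L ≤ #J ∧
      ∀ j ∈ J, ∀ v ∈ W, (((j + v) ⬝ᵥ (j + v) : ℤ) : ℝ) ≤ L ^ 2 ↔ p ⬝ᵥ v ≤ h := by
  obtain ⟨A, hA0, hAv⟩ : ∃ A : ℝ, 0 ≤ A ∧
      ∀ v ∈ W, |((q ⬝ᵥ v : ℤ) : ℝ)| + |((v ⬝ᵥ v : ℤ) : ℝ)| ≤ A :=
    ⟨∑ v ∈ W, (|((q ⬝ᵥ v : ℤ) : ℝ)| + |((v ⬝ᵥ v : ℤ) : ℝ)|),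
      Finset.sum_nonneg fun v _ => by positivity, fun v hv =>
      Finset.single_le_sum (f := fun v : Fin d → ℤ => |((q ⬝ᵥ v : ℤ) : ℝ)| + |((v ⬝ᵥ v : ℤ) : ℝ)|)
        (fun v _ => by positivity) hv⟩
  obtain ⟨al, be, hal0, hlt, hev⟩ := exists_shell_sites ((p ⬝ᵥ p : ℤ) : ℝ) ((q ⬝ᵥ q : ℤ) : ℝ) A
    (by exact_mod_cast hp) (by exact_mod_cast hq) hA0 h hh
  have hbe0 : 0 < be := hal0.trans hlt
  -- Half of the interval length pays for rounding its endpoints to integers.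
  refine ⟨(be - al) / 2, by linarith, ?_⟩
  filter_upwards [hev, eventually_ge_atTop (2 / (be - al)), eventually_gt_atTop 0] with
    L key hL1 hL0
  rw [div_le_iff₀ (by linarith)] at hL1
  choose! s hs using key
  have hinj : Function.Injective fun t : ℕ => (t : ℤ) • p + (s t : ℤ) • q := by
    intro t t' htt
    have h3 := congrArg (fun v => p ⬝ᵥ v) htt
    simp only [dotProduct_add, dotProduct_smul, hpq, smul_eq_mul, mul_zero, add_zero] at h3
    have h4 := mul_right_cancel₀ (by omega : p ⬝ᵥ p ≠ 0) h3
    exact_mod_cast h4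
  refine ⟨(Finset.Icc ⌈al * L⌉₊ ⌊be * L⌋₊).map ⟨_, hinj⟩, ?_, ?_⟩
  · rw [Finset.card_map, Nat.card_Icc]
    have h5 := Nat.lt_floor_add_one (be * L)
    have h6 := Nat.ceil_lt_add_one (show 0 ≤ al * L by positivity)
    have h7 : (((⌊be * L⌋₊ + 1 : ℕ) : ℝ)) ≤
        ((⌊be * L⌋₊ + 1 - ⌈al * L⌉₊ : ℕ) : ℝ) + (⌈al * L⌉₊ : ℝ) := by
      exact_mod_cast (by omega : ⌊be * L⌋₊ + 1 ≤ (⌊be * L⌋₊ + 1 - ⌈al * L⌉₊) + ⌈al * L⌉₊)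
    push_cast at h7
    nlinarith
  · intro j hj v hv
    obtain ⟨t, ht, rfl⟩ := Finset.mem_map.1 hj
    obtain ⟨ht1, ht2⟩ := Finset.mem_Icc.1 ht
    have ht1' := Nat.ceil_le.1 ht1
    have ht2' := (Nat.le_floor_iff (by positivity)).1 ht2
    obtain ⟨hs1, hs2, hs3⟩ := hs t ht1' ht2'
    have hv' := hAv v hv
    refine ball_eq_halfSpace_near hpq t (s t) h A L
      (by linarith [abs_nonneg ((v ⬝ᵥ v : ℤ) : ℝ)])
      (by linarith [abs_nonneg ((q ⬝ᵥ v : ℤ) : ℝ), le_abs_self ((v ⬝ᵥ v : ℤ) : ℝ)]) ?_ hs2 hs3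
    linarith

end Geometry

/-! ### The variance grows at least linearly -/

section Variance

variable {d : ℕ}

theorem sum_abs_shift_le {ρ : (Fin d → ℤ) → ℝ} (hρ : Summable fun v => |ρ v|)
    (J : Finset (Fin d → ℤ)) (a : Fin d → ℤ) : ∑ j ∈ J, |ρ (j - a)| ≤ ∑' v, |ρ v| := by
  have h := hρ.sum_le_tsum (J.map (Equiv.subRight a).toEmbedding) fun _ _ => abs_nonneg _
  rw [Finset.sum_map] at h
  exact h

theorem sum_abs_shift_le' {ρ : (Fin d → ℤ) → ℝ} (hρ : Summable fun v => |ρ v|)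
    (J : Finset (Fin d → ℤ)) (a : Fin d → ℤ) : ∑ j ∈ J, |ρ (a - j)| ≤ ∑' v, |ρ v| := by
  have h := hρ.sum_le_tsum (J.map (Equiv.subLeft a).toEmbedding) fun _ _ => abs_nonneg _
  rw [Finset.sum_map] at h
  exact h

/-- Schur's test: after `2 |r_i r_j| ≤ r_i² + r_j²`, each row and column sum of `|ρ|` is at most the
full sum. -/
theorem quadratic_form_le {ρ : (Fin d → ℤ) → ℝ} (hρ : Summable fun v => |ρ v|)
    (J : Finset (Fin d → ℤ)) (r : (Fin d → ℤ) → ℝ) :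
    ∑ i ∈ J, ∑ j ∈ J, r i * r j * ρ (j - i) ≤ (∑' v, |ρ v|) * ∑ j ∈ J, r j ^ 2 := by
  have h1 : ∀ i j, r i * r j * ρ (j - i) ≤
      r i ^ 2 / 2 * |ρ (j - i)| + r j ^ 2 / 2 * |ρ (j - i)| := by
    intro i j
    have h2 : |r i * r j| ≤ r i ^ 2 / 2 + r j ^ 2 / 2 := by
      rw [abs_le]
      constructor <;> nlinarith [sq_nonneg (r i + r j), sq_nonneg (r i - r j)]
    calc r i * r j * ρ (j - i) ≤ |r i * r j * ρ (j - i)| := le_abs_self _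
      _ = |r i * r j| * |ρ (j - i)| := abs_mul _ _
      _ ≤ (r i ^ 2 / 2 + r j ^ 2 / 2) * |ρ (j - i)| :=
        mul_le_mul_of_nonneg_right h2 (abs_nonneg _)
      _ = _ := by ring
  have h3 : ∑ i ∈ J, ∑ j ∈ J, r i ^ 2 / 2 * |ρ (j - i)| ≤
      ∑ i ∈ J, r i ^ 2 / 2 * ∑' v, |ρ v| := by
    refine Finset.sum_le_sum fun i _ => ?_
    rw [← Finset.mul_sum]
    exact mul_le_mul_of_nonneg_left (sum_abs_shift_le hρ J i) (by positivity)
  have h4 : ∑ i ∈ J, ∑ j ∈ J, r j ^ 2 / 2 * |ρ (j - i)| ≤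
      ∑ j ∈ J, r j ^ 2 / 2 * ∑' v, |ρ v| := by
    rw [Finset.sum_comm]
    refine Finset.sum_le_sum fun j _ => ?_
    rw [← Finset.mul_sum]
    exact mul_le_mul_of_nonneg_left (sum_abs_shift_le' hρ J j) (by positivity)
  have h5 : ∑ j ∈ J, r j ^ 2 / 2 * ∑' v, |ρ v| = (∑' v, |ρ v|) * (∑ j ∈ J, r j ^ 2) / 2 := by
    rw [← Finset.sum_mul, ← Finset.sum_div]
    ring
  calc _ ≤ ∑ i ∈ J, ∑ j ∈ J, (r i ^ 2 / 2 * |ρ (j - i)| + r j ^ 2 / 2 * |ρ (j - i)|) :=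
        Finset.sum_le_sum fun i _ => Finset.sum_le_sum fun j _ => h1 i j
    _ ≤ _ := by
      simp only [Finset.sum_add_distrib]
      linarith

variable {Ω : Type*} [MeasurableSpace Ω] {P : Measure Ω} {X : (Fin d → ℤ) → Ω → ℝ}
  {ρ : (Fin d → ℤ) → ℝ}

theorem integral_sum_mul_sum (hX : ∀ i, HasAllMoments (X i) P)
    (hcov : ∀ i j, ∫ ω, X i ω * X j ω ∂P = ρ (j - i)) (Λ J : Finset (Fin d → ℤ))
    (a r : (Fin d → ℤ) → ℝ) :
    ∫ ω, (∑ i ∈ Λ, a i * X i ω) * (∑ j ∈ J, r j * X j ω) ∂P =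
      ∑ i ∈ Λ, ∑ j ∈ J, a i * r j * ρ (j - i) := by
  have hint : ∀ i j, Integrable (fun ω => a i * X i ω * (r j * X j ω)) P := by
    intro i j
    have := (((hX i).mul (hX j)).integrable).const_mul (a i * r j)
    refine this.congr (Eventually.of_forall fun ω => ?_)
    ring
  simp only [Finset.sum_mul_sum]
  rw [integral_finsetSum _ fun i _ => integrable_finsetSum _ fun j _ => hint i j]
  refine Finset.sum_congr rfl fun i _ => ?_
  rw [integral_finsetSum _ fun j _ => hint i j]
  refine Finset.sum_congr rfl fun j _ => ?_
  rw [← hcov, ← integral_const_mul]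
  congr 1
  funext ω
  ring

/-- Bessel-type lower bound for the second moment of a sum over `Λ`. -/
theorem sum_sq_le_integral_sq [IsProbabilityMeasure P] (hX : ∀ i, HasAllMoments (X i) P)
    (hcov : ∀ i j, ∫ ω, X i ω * X j ω ∂P = ρ (j - i)) (hρ : Summable fun v => |ρ v|)
    (hR : 0 < ∑' v, |ρ v|) (Λ J : Finset (Fin d → ℤ)) :
    ∑ j ∈ J, (∑ i ∈ Λ, ρ (i - j)) ^ 2 ≤ (∑' v, |ρ v|) * ∫ ω, (∑ i ∈ Λ, X i ω) ^ 2 ∂P := by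
  set R := ∑' v, |ρ v|
  set r : (Fin d → ℤ) → ℝ := fun j => ∑ i ∈ Λ, ρ (i - j) with hr
  have hQ : HasAllMoments (fun ω => ∑ i ∈ Λ, X i ω) P := HasAllMoments.sum Λ hX
  have hsX : ∀ j, HasAllMoments (fun ω => r j * X j ω) P := fun j p => (hX j p).const_mul _
  have hY : HasAllMoments (fun ω => ∑ j ∈ J, r j * X j ω) P := HasAllMoments.sum J hsX
  have hYQ : ∫ ω, (∑ j ∈ J, r j * X j ω) * (∑ i ∈ Λ, X i ω) ∂P = ∑ j ∈ J, r j ^ 2 := by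
    have := integral_sum_mul_sum hX hcov J Λ r fun _ => 1
    simp only [one_mul, mul_one] at this
    rw [this]
    refine Finset.sum_congr rfl fun j _ => ?_
    rw [← Finset.mul_sum, sq]
  have hYY : ∫ ω, (∑ j ∈ J, r j * X j ω) * (∑ j ∈ J, r j * X j ω) ∂P ≤ R * ∑ j ∈ J, r j ^ 2 := by
    rw [integral_sum_mul_sum hX hcov]
    exact quadratic_form_le hρ J r
  -- Here `r j` is the covariance of the sum over `Λ` with `X j`. The cross term is `-2 R ∑ r_j²`
  -- and the last term at most `R ∑ r_j²`, so nonnegativity of the square gives the bound.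
  have hexp : ∫ ω, (R * ∑ i ∈ Λ, X i ω - ∑ j ∈ J, r j * X j ω) ^ 2 ∂P =
      R ^ 2 * ∫ ω, (∑ i ∈ Λ, X i ω) ^ 2 ∂P - 2 * R * ∑ j ∈ J, r j ^ 2 +
        ∫ ω, (∑ j ∈ J, r j * X j ω) * (∑ j ∈ J, r j * X j ω) ∂P := by
    have hi1 : Integrable (fun ω => R ^ 2 * (∑ i ∈ Λ, X i ω) ^ 2) P :=
      (hQ.integrable_pow 2).const_mul _
    have hi2 : Integrable (fun ω => 2 * R * ((∑ j ∈ J, r j * X j ω) * ∑ i ∈ Λ, X i ω)) P :=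
      (hY.mul hQ).integrable.const_mul _
    have hi3 : Integrable (fun ω => R ^ 2 * (∑ i ∈ Λ, X i ω) ^ 2 -
        2 * R * ((∑ j ∈ J, r j * X j ω) * ∑ i ∈ Λ, X i ω)) P := hi1.sub hi2
    rw [← hYQ, ← integral_const_mul, ← integral_const_mul, ← integral_sub hi1 hi2,
      ← integral_add hi3 (hY.mul hY).integrable]
    congr 1
    funext ω
    ring
  have h0 : 0 ≤ ∫ ω, (R * ∑ i ∈ Λ, X i ω - ∑ j ∈ J, r j * X j ω) ^ 2 ∂P :=
    integral_nonneg fun _ => sq_nonneg _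
  rw [hexp] at h0
  have h1 : 0 ≤ R * (R * ∫ ω, (∑ i ∈ Λ, X i ω) ^ 2 ∂P - ∑ j ∈ J, r j ^ 2) := by
    linarith
  have := nonneg_of_mul_nonneg_right h1 hR
  linarith

theorem exists_box_tail (hρ : Summable fun v => |ρ v|) {ε : ℝ} (hε : 0 < ε) :
    ∃ K : ℕ, ∀ T : Finset (Fin d → ℤ), (∀ v ∈ T, ∃ k, (K : ℤ) < |v k|) → ∑ v ∈ T, |ρ v| < ε := by
  obtain ⟨S, hS⟩ := summable_iff_vanishing_norm.1 hρ ε hε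
  refine ⟨∑ v ∈ S, ∑ k, (v k).natAbs, fun T hT => ?_⟩
  have hdisj : Disjoint T S := by
    rw [Finset.disjoint_left]
    intro v hvT hvS
    obtain ⟨k, hk⟩ := hT v hvT
    have h1 : (v k).natAbs ≤ ∑ k, (v k).natAbs :=
      Finset.single_le_sum (f := fun k => (v k).natAbs) (fun _ _ => Nat.zero_le _)
        (Finset.mem_univ k)
    have h2 : ∑ k, (v k).natAbs ≤ ∑ v ∈ S, ∑ k, (v k).natAbs :=
      Finset.single_le_sum (f := fun v : Fin d → ℤ => ∑ k, (v k).natAbs)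
        (fun _ _ => Nat.zero_le _) hvS
    have h3 : ((v k).natAbs : ℤ) = |v k| := Int.natCast_natAbs _
    have h4 : ((v k).natAbs : ℤ) ≤ ((∑ v ∈ S, ∑ k, (v k).natAbs : ℕ) : ℤ) := by
      exact_mod_cast h1.trans h2
    rw [h3] at h4
    exact absurd hk (not_lt.2 h4)
  exact (le_abs_self _).trans_lt (hS T hdisj)

/-- The sites of the ball of radius `L`. -/
noncomputable def sites (d : ℕ) (L : ℝ) : Finset (Fin d → ℤ) := (finite_sites_ball d L).toFinset

theorem mem_sites {L : ℝ} (hL : 0 ≤ L) (i : Fin d → ℤ) :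
    i ∈ sites d L ↔ ((i ⬝ᵥ i : ℤ) : ℝ) ≤ L ^ 2 := by
  rw [sites, Set.Finite.mem_toFinset, Set.mem_ofPred_eq, toSpace_mem_ball_iff i hL]

/-- In some direction `p`, one of the half-space sums of `ρ` over a large window does not vanish. -/
theorem exists_halfSpace_sum (hd : 2 ≤ d) (hρ0 : ρ 0 = 1) (K : ℕ) (W : Finset (Fin d → ℤ))
    (hW : ∀ v, v ∈ W ↔ ∀ k, |v k| ≤ (K : ℤ)) :
    ∃ (p q : Fin d → ℤ) (h : ℤ), p ⬝ᵥ q = 0 ∧ 1 ≤ p ⬝ᵥ p ∧ 1 ≤ q ⬝ᵥ q ∧ (h = 0 ∨ h = -1) ∧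
      1 / 2 ≤ |∑ v ∈ W with p ⬝ᵥ v ≤ h, ρ v| := by
  obtain ⟨d, rfl⟩ : ∃ n, d = n + 2 := ⟨d - 2, by omega⟩
  -- The hyperplane orthogonal to `p` meets the window only at the origin. The vector `q = (K + 1,
  -- -1, 0, …)` is orthogonal to `p`; its second coordinate is where `d ≥ 2` enters.
  set p : Fin (d + 2) → ℤ := fun k => ((K : ℤ) + 1) ^ (k : ℕ) with hp
  set q : Fin (d + 2) → ℤ := Fin.cons ((K : ℤ) + 1) (Fin.cons (-1) fun _ => 0) with hq
  have hpq : p ⬝ᵥ q = 0 := by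
    simp [hp, hq, dotProduct, Fin.sum_univ_succ]
  have hpp : 1 ≤ p ⬝ᵥ p := by
    simp only [hp, dotProduct, Fin.sum_univ_succ, Fin.val_zero, pow_zero, one_mul]
    have : 0 ≤ ∑ i : Fin d, ((K : ℤ) + 1) ^ (i.succ.succ : ℕ) * ((K : ℤ) + 1) ^ (i.succ.succ : ℕ) :=
      Finset.sum_nonneg fun _ _ => by positivity
    nlinarith [sq_nonneg (((K : ℤ) + 1) ^ ((0 : Fin (d + 1)).succ : ℕ))]
  have hqq : 1 ≤ q ⬝ᵥ q := by
    simp only [hq, dotProduct, Fin.sum_univ_succ, Fin.cons_zero, Fin.cons_succ, mul_zero,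
      Finset.sum_const_zero]
    nlinarith [sq_nonneg ((K : ℤ) + 1)]
  have hdiff : ∑ v ∈ W with p ⬝ᵥ v ≤ 0, ρ v = (∑ v ∈ W with p ⬝ᵥ v ≤ -1, ρ v) + 1 := by
    have hunion : {v ∈ W | p ⬝ᵥ v ≤ 0} = insert 0 {v ∈ W | p ⬝ᵥ v ≤ -1} := by
      ext v
      simp only [Finset.mem_filter, Finset.mem_insert]
      constructor
      · rintro ⟨hv, hle⟩
        rcases eq_or_lt_of_le hle with h0 | hlt
        · exact Or.inl (eq_zero_of_dotProduct_powers K v ((hW v).1 hv) h0)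
        · exact Or.inr ⟨hv, by omega⟩
      · rintro (rfl | ⟨hv, hle⟩)
        · exact ⟨(hW 0).2 fun k => by simp, by simp⟩
        · exact ⟨hv, by omega⟩
    rw [hunion, Finset.sum_insert (by simp), hρ0, add_comm]
  by_cases h0 : 1 / 2 ≤ |∑ v ∈ W with p ⬝ᵥ v ≤ 0, ρ v|
  · exact ⟨p, q, 0, hpq, hpp, hqq, Or.inl rfl, h0⟩
  · refine ⟨p, q, -1, hpq, hpp, hqq, Or.inr rfl, ?_⟩
    rw [hdiff, not_le, abs_lt] at h0
    rw [le_abs]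
    right
    linarith [h0.2]

/-- At each site of `J` the window contributes at least `1/2` to the covariance in absolute value
and the tail outside it less than `1/4`. Each squared covariance is then at least `1/16`, and `J`
has linearly many sites. -/
theorem exists_linear_le_integral_sq [IsProbabilityMeasure P] (hd : 2 ≤ d)
    (hX : ∀ i, HasAllMoments (X i) P)
    (hcov : ∀ i j, ∫ ω, X i ω * X j ω ∂P = ρ (j - i)) (hρ : Summable fun v => |ρ v|)
    (hρ0 : ρ 0 = 1) :
    ∃ c : ℝ, 0 < c ∧ ∀ᶠ L : ℝ in atTop, c * L ≤ ∫ ω, (∑ i ∈ sites d L, X i ω) ^ 2 ∂P := by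
  have hR : 0 < ∑' v, |ρ v| := hρ.tsum_pos (fun _ => abs_nonneg _) 0 (by simp [hρ0])
  obtain ⟨K, hK⟩ := exists_box_tail hρ (show (0 : ℝ) < 1 / 4 by norm_num)
  obtain ⟨W, hW⟩ : ∃ W : Finset (Fin d → ℤ), ∀ v, v ∈ W ↔ ∀ k, |v k| ≤ (K : ℤ) :=
    ⟨Fintype.piFinset fun _ => Finset.Icc (-(K : ℤ)) K, fun v => by simp [abs_le]⟩
  obtain ⟨p, q, h, hpq, hpp, hqq, hh, hhalf⟩ := exists_halfSpace_sum hd hρ0 K W hW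
  obtain ⟨c, hc, hev⟩ := exists_many_halfSpace_windows hpq hpp hqq W h hh
  refine ⟨c / 16 / ∑' v, |ρ v|, by positivity, ?_⟩
  filter_upwards [hev, eventually_ge_atTop 0] with L hJ hL
  obtain ⟨J, hJc, hJ⟩ := hJ
  have hr : ∀ j ∈ J, (1 / 16 : ℝ) ≤ (∑ i ∈ sites d L, ρ (i - j)) ^ 2 := by
    intro j hj
    set V := (sites d L).map (Equiv.subRight j).toEmbedding with hV
    have hmemV : ∀ v, v ∈ V ↔ j + v ∈ sites d L := by
      intro v
      rw [hV, Finset.mem_map_equiv]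
      simp [add_comm]
    have hsumV : ∑ i ∈ sites d L, ρ (i - j) = ∑ v ∈ V, ρ v := by
      rw [hV, Finset.sum_map]
      rfl
    have hin : {v ∈ V | v ∈ W} = {v ∈ W | p ⬝ᵥ v ≤ h} := by
      ext v
      simp only [Finset.mem_filter, hmemV, mem_sites hL]
      constructor
      · rintro ⟨h1, h2⟩
        exact ⟨h2, (hJ j hj v h2).1 h1⟩
      · rintro ⟨h1, h2⟩
        exact ⟨(hJ j hj v h1).2 h2, h1⟩
    have hout : |∑ v ∈ V with v ∉ W, ρ v| < 1 / 4 := by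
      refine (Finset.abs_sum_le_sum_abs _ _).trans_lt (hK _ fun v hv => ?_)
      have h3 := (Finset.mem_filter.1 hv).2
      rw [hW] at h3
      push Not at h3
      exact h3
    rw [hsumV, ← Finset.sum_filter_add_sum_filter_not V (· ∈ W), hin]
    have h4 : (1 / 4 : ℝ) ≤ |∑ v ∈ W with p ⬝ᵥ v ≤ h, ρ v + ∑ v ∈ V with v ∉ W, ρ v| := by
      have h5 := abs_sub_abs_le_abs_add (∑ v ∈ W with p ⬝ᵥ v ≤ h, ρ v) (∑ v ∈ V with v ∉ W, ρ v)
      linarith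
    have h6 := pow_le_pow_left₀ (by norm_num) h4 2
    rw [sq_abs] at h6
    norm_num at h6 ⊢
    exact h6
  have h7 := sum_sq_le_integral_sq hX hcov hρ hR (sites d L) J
  have h8 := Finset.card_nsmul_le_sum J _ _ hr
  rw [nsmul_eq_mul] at h8
  rw [div_mul_eq_mul_div, div_le_iff₀ hR]
  linarith

end Variance

/-! ### The central limit theorem -/

theorem card_sites_le (d : ℕ) {L : ℝ} (hL : 1 ≤ L) : (#(sites d L) : ℝ) ≤ (5 * L) ^ d := by
  have hsub : sites d L ⊆ Fintype.piFinset fun _ : Fin d => Finset.Icc (-⌈L⌉) ⌈L⌉ := by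
    intro i hi
    rw [mem_sites (by linarith)] at hi
    rw [Fintype.mem_piFinset]
    intro k
    rw [Finset.mem_Icc, ← abs_le]
    have h1 : i k * i k ≤ i ⬝ᵥ i :=
      Finset.single_le_sum (f := fun k => i k * i k) (fun k _ => mul_self_nonneg _)
        (Finset.mem_univ k)
    have h2 : ((i k : ℝ)) ^ 2 ≤ L ^ 2 := by
      refine le_trans ?_ hi
      rw [sq]
      exact_mod_cast h1
    have h3 := abs_le_of_sq_le_sq h2 (by linarith)
    have h4 : |(i k : ℝ)| ≤ (⌈L⌉ : ℝ) := h3.trans (Int.le_ceil L)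
    exact_mod_cast h4
  have h5 := Finset.card_le_card hsub
  rw [Fintype.card_piFinset, Finset.prod_const, Finset.card_univ, Fintype.card_fin,
    Int.card_Icc] at h5
  -- For `L ≥ 1`, `2 ⌈L⌉ + 1 ≤ 2 L + 3 ≤ 5 L`.
  have h6 : (((⌈L⌉ + 1 - -⌈L⌉).toNat : ℕ) : ℝ) ≤ 5 * L := by
    have h7 : 0 < ⌈L⌉ := Int.ceil_pos.2 (by linarith)
    have h8 : (((⌈L⌉ + 1 - -⌈L⌉).toNat : ℤ)) = ⌈L⌉ + 1 - -⌈L⌉ := Int.toNat_of_nonneg (by omega)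
    have h9 : (((⌈L⌉ + 1 - -⌈L⌉).toNat : ℕ) : ℝ) = (⌈L⌉ : ℝ) + 1 - -(⌈L⌉ : ℝ) := by
      exact_mod_cast congrArg (fun z : ℤ => (z : ℝ)) h8
    rw [h9]
    linarith [Int.ceil_lt_add_one L]
  calc (#(sites d L) : ℝ) ≤ (((⌈L⌉ + 1 - -⌈L⌉).toNat ^ d : ℕ) : ℝ) := by exact_mod_cast h5
    _ = (((⌈L⌉ + 1 - -⌈L⌉).toNat : ℕ) : ℝ) ^ d := by push_cast; rfl
    _ ≤ _ := pow_le_pow_left₀ (Nat.cast_nonneg _) h6 d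

theorem localMass_ball {Ω : Type*} {d : ℕ} (X : (Fin d → ℤ) → Ω → ℝ) (L : ℝ) :
    localMass X (ball d L) = fun ω => ∑ i ∈ sites d L, X i ω := by
  funext ω
  exact finsum_mem_eq_finite_toFinset_sum _ (finite_sites_ball d L)

section CentralLimit

variable {Ω : Type*} [MeasurableSpace Ω] {P : Measure Ω} [IsProbabilityMeasure P]

/-- A variable whose cumulants of large order vanish asymptotically after normalisation satisfies
the central limit theorem. -/
theorem tendstoInDistribution_of_cumulants {ι : Type*} {l : Filter ι} [l.IsCountablyGenerated]
    (Y : ι → Ω → ℝ) (hY : ∀ i, HasAllMoments (Y i) P) (h1 : ∀ i, ∫ ω, Y i ω ∂P = 0)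
    (h2 : ∀ᶠ i in l, ∫ ω, Y i ω ^ 2 ∂P = 1) (s : ℕ)
    (hs : ∀ n, s < n → Tendsto (fun i => cumulantOf (fun k => ∫ ω, Y i ω ^ k ∂P) n) l (𝓝 0)) :
    TendstoInDistribution Y l (id : ℝ → ℝ) (fun _ => P) (gaussianReal 0 1) := by
  have hm0 : ∀ i, ∫ ω, Y i ω ^ 0 ∂P = 1 := fun i => by simp
  have hc1 : ∀ i, cumulantOf (fun k => ∫ ω, Y i ω ^ k ∂P) 1 = 0 := fun i => by
    rw [cumulantOf_succ]
    simp [h1]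
  have hc2 : ∀ i, cumulantOf (fun k => ∫ ω, Y i ω ^ k ∂P) 2 = ∫ ω, Y i ω ^ 2 ∂P := fun i => by
    rw [cumulantOf_succ]
    simp [hc1]
  have hpos : ∀ i, ExpPositive fun k => ∫ ω, Y i ω ^ k ∂P := fun i =>
    expPositive_moments P (Y i) (hY i).integrable_pow
  have hc3 := tendsto_cumulant_zero (fun i k => ∫ ω, Y i ω ^ k ∂P) hm0 hpos s
    (Eventually.of_forall fun i => by simp [hc1]) (h2.mono fun i hi => by simp [hc2, hi]) hs
  have hc : ∀ n, 1 ≤ n → Tendsto (fun i => cumulantOf (fun k => ∫ ω, Y i ω ^ k ∂P) n) l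
      (𝓝 (normalCumulant n)) := by
    intro n hn
    obtain rfl | rfl | h3 : n = 1 ∨ n = 2 ∨ 3 ≤ n := by omega
    · simpa [hc1, normalCumulant] using tendsto_const_nhds
    · rw [normalCumulant, if_pos rfl]
      exact tendsto_const_nhds.congr' (h2.mono fun i hi => ((hc2 i).trans hi).symm)
    · rw [normalCumulant, if_neg (by omega)]
      exact hc3 n h3
  refine tendstoInDistribution_of_moments P Y (fun i => (hY i 1).aestronglyMeasurable.aemeasurable)
    (fun i => (hY i).integrable_pow) fun n => ?_
  refine (tendsto_momentOf hc n).congr fun i => ?_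
  rw [momentOf_cumulantOf _ (hm0 i)]

variable {d : ℕ} {X : (Fin d → ℤ) → Ω → ℝ}

theorem integral_mul_eq_truncCorr (hmean : ∀ i, P[X i] = 0) (hinv : TranslationInvariant X P)
    (i j : Fin d → ℤ) : ∫ ω, X i ω * X j ω ∂P =
      truncCorr X P (Fin.cons 0 (fun _ => j - i) : Fin 2 → Fin d → ℤ) := by
  rw [← hinv.truncCorr_add _ i, truncCorr_pair hmean]
  change _ = ∫ ω, X (0 + i) ω * X (j - i + i) ω ∂P
  rw [zero_add, sub_add_cancel]

theorem exists_linear_le_second_moment (hd : 2 ≤ d) (hX : ∀ i, HasAllMoments (X i) P)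
    (hmean : ∀ i, P[X i] = 0) (hvar : ∀ i, Var[X i; P] = 1) (hinv : TranslationInvariant X P)
    (hsum : SummableTruncCorr X P) :
    ∃ c : ℝ, 0 < c ∧ ∀ᶠ L : ℝ in atTop, c * L ≤ ∫ ω, (∑ i ∈ sites d L, X i ω) ^ 2 ∂P := by
  refine exists_linear_le_integral_sq
    (ρ := fun v => truncCorr X P (Fin.cons 0 (fun _ => v) : Fin 2 → Fin d → ℤ)) hd hX
    (integral_mul_eq_truncCorr hmean hinv) ?_ ?_
  · have h := ((hsum 1).1 0).abs
    exact h.comp_injective (Equiv.funUnique (Fin 1) (Fin d → ℤ)).symm.injective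
  · have h := integral_mul_eq_truncCorr hmean hinv 0 0
    rw [sub_zero] at h
    rw [← h, ← hvar 0, variance_of_integral_eq_zero (hX 0).integrable.aemeasurable (hmean 0)]
    simp only [sq]

end CentralLimit

end LatticeField

open LatticeField in
theorem theorem5 {Ω : Type*} [MeasurableSpace Ω] (P : Measure Ω) [IsProbabilityMeasure P]
    (d : ℕ) (hd : 2 ≤ d) (X : (Fin d → ℤ) → Ω → ℝ)
    (hmom : ∀ (i : Fin d → ℤ) (p : ℕ), MemLp (X i) p P)
    (hmean : ∀ i : Fin d → ℤ, P[X i] = 0)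
    (hvar : ∀ i : Fin d → ℤ, Var[X i; P] = 1)
    (hinv : LatticeField.TranslationInvariant X P)
    (hsum : LatticeField.SummableTruncCorr X P) :
    TendstoInDistribution
      (fun (L : ℝ) (ω : Ω) =>
        (LatticeField.localMass X (LatticeField.ball d L) ω
            - P[LatticeField.localMass X (LatticeField.ball d L)])
          / √(Var[LatticeField.localMass X (LatticeField.ball d L); P]))
      atTop (id : ℝ → ℝ) (fun _ => P) (gaussianReal 0 1) := by
  have hX : ∀ i, HasAllMoments (X i) P := hmom
  have hQ : ∀ L, HasAllMoments (fun ω => ∑ i ∈ sites d L, X i ω) P := fun L =>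
    HasAllMoments.sum _ hX
  have hQ0 : ∀ L, ∫ ω, ∑ i ∈ sites d L, X i ω ∂P = 0 := fun L => by
    rw [integral_finsetSum _ fun i _ => (hX i).integrable]
    exact Finset.sum_eq_zero fun i _ => hmean i
  have hV : ∀ L, Var[fun ω => ∑ i ∈ sites d L, X i ω; P] =
      ∫ ω, (∑ i ∈ sites d L, X i ω) ^ 2 ∂P := fun L =>
    variance_of_integral_eq_zero (hQ L).integrable.aemeasurable (hQ0 L)
  simp only [localMass_ball, hV, hQ0, sub_zero]
  set V : ℝ → ℝ := fun L => ∫ ω, (∑ i ∈ sites d L, X i ω) ^ 2 ∂P with hVdef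
  obtain ⟨c, hc, hcV⟩ := exists_linear_le_second_moment hd hX hmean hvar hinv hsum
  have hmoments : ∀ L n, ∫ ω, ((∑ i ∈ sites d L, X i ω) / √(V L)) ^ n ∂P =
      (√(V L))⁻¹ ^ n * ∫ ω, (∑ i ∈ sites d L, X i ω) ^ n ∂P := fun L n => by
    rw [← integral_const_mul]
    congr 1
    funext ω
    rw [div_eq_inv_mul, mul_pow]
  have hcum : ∀ L n, cumulantOf (fun k => ∫ ω, ((∑ i ∈ sites d L, X i ω) / √(V L)) ^ k ∂P) n =
      (√(V L))⁻¹ ^ n * cumulantOf (fun k => ∫ ω, (∑ i ∈ sites d L, X i ω) ^ k ∂P) n :=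
    fun L n => by
      rw [← cumulantOf_mul_pow]
      exact congrArg (cumulantOf · n) (funext fun k => hmoments L k)
  have hVtop : Tendsto V atTop atTop :=
    tendsto_atTop_mono' _ hcV (tendsto_id.const_mul_atTop hc)
  have hinvlim : Tendsto (fun L => (√(V L))⁻¹) atTop (𝓝 0) :=
    tendsto_inv_atTop_zero.comp (Real.tendsto_sqrt_atTop.comp hVtop)
  -- Order `2 * d` is the threshold at which `V ^ (n / 2)`, with `V ≥ c L`, overtakes the volume
  -- factor `L ^ d`.
  refine tendstoInDistribution_of_cumulants _ (fun L p => ?_) (fun L => ?_) ?_ (2 * d) fun n hn => ?_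
  · simp only [div_eq_inv_mul]
    exact (hQ L p).const_mul _
  · rw [integral_div, hQ0, zero_div]
  · filter_upwards [hVtop.eventually_gt_atTop 0] with L hL
    rw [hmoments, inv_pow, Real.sq_sqrt hL.le]
    exact inv_mul_cancel₀ hL.ne'
  · refine Tendsto.congr (fun L => (hcum L n).symm) ?_
    obtain ⟨n, rfl⟩ : ∃ k, n = k + 1 := ⟨n - 1, by omega⟩
    obtain ⟨C, hC0, hC⟩ := exists_abs_cumulantOf_sum_le hX hinv hsum n
    have hlim : Tendsto (fun L => C * (5 / c) ^ d * (√(V L))⁻¹ ^ (n + 1 - 2 * d)) atTop (𝓝 0) := by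
      have h := (hinvlim.pow (n + 1 - 2 * d)).const_mul (C * (5 / c) ^ d)
      rwa [zero_pow (by omega), mul_zero] at h
    refine squeeze_zero_norm' ?_ hlim
    filter_upwards [hcV, eventually_ge_atTop 1] with L hL1 hL2
    have hV0 : 0 < V L := lt_of_lt_of_le (by positivity) hL1
    have hs0 : 0 ≤ (√(V L))⁻¹ := by positivity
    have hsq : (√(V L))⁻¹ ^ 2 ≤ (c * L)⁻¹ := by
      rw [inv_pow, Real.sq_sqrt hV0.le]
      exact inv_anti₀ (by positivity) hL1
    -- The first `2 * d` factors cancel the volume; at least one factor is left and tends to zero.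
    have hpow : (√(V L))⁻¹ ^ (n + 1) =
        ((√(V L))⁻¹ ^ 2) ^ d * (√(V L))⁻¹ ^ (n + 1 - 2 * d) := by
      rw [← pow_mul, ← pow_add]
      congr 1
      omega
    rw [Real.norm_eq_abs, abs_mul, abs_of_nonneg (pow_nonneg hs0 _), hpow]
    calc ((√(V L))⁻¹ ^ 2) ^ d * (√(V L))⁻¹ ^ (n + 1 - 2 * d) *
          |cumulantOf (fun k => ∫ ω, (∑ i ∈ sites d L, X i ω) ^ k ∂P) (n + 1)|
        ≤ ((c * L)⁻¹) ^ d * (√(V L))⁻¹ ^ (n + 1 - 2 * d) * (C * (5 * L) ^ d) := by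
          refine mul_le_mul (mul_le_mul_of_nonneg_right (pow_le_pow_left₀ (sq_nonneg _) hsq d)
            (by positivity)) ?_ (abs_nonneg _) (by positivity)
          exact (hC _).trans (mul_le_mul_of_nonneg_left (card_sites_le d hL2) hC0)
      _ = C * (5 / c) ^ d * (√(V L))⁻¹ ^ (n + 1 - 2 * d) := by
          have h3 : 5 / c = (c * L)⁻¹ * (5 * L) := by
            field_simp
          rw [h3, mul_pow]
          ring
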